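/- Let $n, m, r$ be integers with $r \ge 1$, let $S \subseteq \mathbb{R}^n$ be an $r$-dimensional subspace with orthogonal projection $P_S$, and let $$\mu(S) = \frac{n}{r}\max_{1\le j\le n}\|P_S e_j\|_2^2$$ be its coherence, where $e_j$ are the standard basis vectors. For $z \in \mathbb{R}^n$, $z\neq 0$, let $\mu(z) = n\|z\|_\infty^2/\|z\|_2^2$ be the coherence of the line spanned by $z$ (and $\mu(0)=0$). Let $v = x + y$ with $x \in S$, $y \in S^\perp$. Let $\Omega = (\Omega(1),\dots,\Omega(m))$ be $m$ indices drawn independently and uniformly (with replacement) from $\{1,\dots,n\}$, and let $v_\Omega = (v_{\Omega(1)},\dots,v_{\Omega(m)})$. Let $U$ be any $n\times r$ matrix whose columns span $S$, let $U_\Omega$ be the $m \times r$ matrix whose $k$-th row is the $\Omega(k)$-th row of $U$, and put $P_{S_\Omega} = U_\Omega (U_\Omega^T U_\Omega)^\dagger U_\Omega^T$, where $\dagger$ is the Moore–Penrose pseudoinverse. Let $\delta > 0$ and $m \ge \frac{8}{3}\, r\,\mu(S) \log\left(\frac{2r}{\delta}\right)$, and set $$\alpha = \sqrt{\frac{2\mu(y)^2}{m}\log\left(\frac1\delta\right)},\qquad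 \beta = \sqrt{2\mu(y)\log\left(\frac1\delta\right)},\qquad \gamma = \sqrt{\frac{8 r\mu(S)}{3m}\log\left(\frac{2r}{\delta}\right)}.$$ Then, with probability at least $1-4\delta$, both $$\frac{m(1-\alpha) - r\mu(S)\frac{(1+\beta)^2}{1-\gamma}}{n}\,\|v-P_Sv\|_2^2 \;\le\; \|v_\Omega - P_{S_\Omega}v_\Omega\|_2^2$$ and $$\|v_\Omega - P_{S_\Omega}v_\Omega\|_2^2 \;\le\; (1+\alpha)\,\frac{m}{n}\,\|v-P_Sv\|_2^2$$ hold, where the first inequality is asserted when $\gamma < 1$ (if $\gamma = 1$, i.e. $m$ equals the threshold, its left-hand side is read as $-\infty$). When $1-4\delta\le 0$ the assertion is vacuous, so logarithms and square roots of non-positive or undefined expressions play no role. -/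

import Mathlib

open MeasureTheory ProbabilityTheory
open scoped Matrix

/-- The coherence `μ(S) = (n / r) max_j ‖P_S e_j‖²` of a subspace `S` of `ℝⁿ` of dimension `r`. -/
noncomputable def coherence {n : ℕ} (S : Submodule ℝ (EuclideanSpace ℝ (Fin n))) : ℝ :=
  (n : ℝ) / (Module.finrank ℝ S : ℝ) *
    ⨆ j : Fin n, ‖S.starProjection (EuclideanSpace.single j (1 : ℝ))‖ ^ 2

/-- The coherence of a vector is the coherence of the subspace that it spans. -/
noncomputable def vecCoherence {n : ℕ} (z : EuclideanSpace ℝ (Fin n)) : ℝ :=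
  coherence (Submodule.span ℝ {z})

/-- `B` is a Moore–Penrose inverse of the real matrix `A` (the four Penrose equations). -/
structure IsPseudoinverse {k l : ℕ} (A : Matrix (Fin k) (Fin l) ℝ)
    (B : Matrix (Fin l) (Fin k) ℝ) : Prop where
  mul_mul_self : A * B * A = A
  mul_mul_inv : B * A * B = B
  symm_left : (A * B)ᵀ = A * B
  symm_right : (B * A)ᵀ = B * A

theorem IsPseudoinverse.unique {k l : ℕ} {A : Matrix (Fin k) (Fin l) ℝ}
    {B C : Matrix (Fin l) (Fin k) ℝ} (hB : IsPseudoinverse A B) (hC : IsPseudoinverse A C) :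
    B = C := by
  have h1 : A * B = A * C := by
    calc A * B = (A * B)ᵀ := hB.symm_left.symm
      _ = ((A * C) * (A * B))ᵀ := by
        rw [← Matrix.mul_assoc, hC.mul_mul_self]
      _ = (A * B) * (A * C) := by
        rw [Matrix.transpose_mul, hB.symm_left, hC.symm_left]
      _ = A * C := by rw [← Matrix.mul_assoc, hB.mul_mul_self]
  have h2 : B * A = C * A := by
    calc B * A = (B * A)ᵀ := hB.symm_right.symm
      _ = ((B * A) * (C * A))ᵀ := by
        rw [Matrix.mul_assoc B A, ← Matrix.mul_assoc A, hC.mul_mul_self]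
      _ = (C * A) * (B * A) := by
        rw [Matrix.transpose_mul, hB.symm_right, hC.symm_right]
      _ = C * A := by rw [Matrix.mul_assoc C A, ← Matrix.mul_assoc A, hB.mul_mul_self]
  calc B = B * A * B := hB.mul_mul_inv.symm
    _ = C * A * B := by rw [h2]
    _ = C * (A * C) := by rw [Matrix.mul_assoc, h1]
    _ = C := by rw [← Matrix.mul_assoc, hC.mul_mul_inv]

theorem exists_isPseudoinverse_of_symm {l : ℕ} (A : Matrix (Fin l) (Fin l) ℝ) (hA : Aᵀ = A) :
    ∃ B : Matrix (Fin l) (Fin l) ℝ, Bᵀ = B ∧ IsPseudoinverse A B := by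
  have hH : A.IsHermitian := by
    rw [Matrix.IsHermitian, Matrix.conjTranspose_eq_transpose_of_trivial, hA]
  obtain ⟨V, d, hV, hAV⟩ : ∃ (V : Matrix (Fin l) (Fin l) ℝ) (d : Fin l → ℝ),
      Vᵀ * V = 1 ∧ A = V * Matrix.diagonal d * Vᵀ := by
    refine ⟨hH.eigenvectorUnitary, hH.eigenvalues, ?_, ?_⟩
    · have := Unitary.coe_star_mul_self hH.eigenvectorUnitary
      simpa [Matrix.star_eq_conjTranspose, Matrix.conjTranspose_eq_transpose_of_trivial] using this
    · have := hH.spectral_theorem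
      simpa [Unitary.conjStarAlgAut_apply, Matrix.star_eq_conjTranspose,
        Matrix.conjTranspose_eq_transpose_of_trivial, Function.comp_def] using this
  have key : ∀ e f : Fin l → ℝ, (V * Matrix.diagonal e * Vᵀ) * (V * Matrix.diagonal f * Vᵀ) =
      V * Matrix.diagonal (fun i => e i * f i) * Vᵀ := by
    intro e f
    calc (V * Matrix.diagonal e * Vᵀ) * (V * Matrix.diagonal f * Vᵀ)
        = V * Matrix.diagonal e * (Vᵀ * V) * Matrix.diagonal f * Vᵀ := by
          simp only [Matrix.mul_assoc]
      _ = _ := by rw [hV, Matrix.mul_one, Matrix.mul_assoc V, Matrix.diagonal_mul_diagonal]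
  have symm : ∀ e : Fin l → ℝ, (V * Matrix.diagonal e * Vᵀ)ᵀ = V * Matrix.diagonal e * Vᵀ := by
    intro e
    simp [Matrix.transpose_mul, Matrix.mul_assoc]
  have h3 : ∀ x : ℝ, x * x⁻¹ * x = x := fun x => mul_inv_mul_cancel x
  have h4 : ∀ x : ℝ, x⁻¹ * x * x⁻¹ = x⁻¹ := fun x => by simpa using mul_inv_mul_cancel x⁻¹
  refine ⟨V * Matrix.diagonal (fun i => (d i)⁻¹) * Vᵀ, symm _, ?_, ?_, ?_, ?_⟩
  · rw [hAV, key, key]; simp only [h3]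
  · rw [hAV, key, key]; simp only [h4]
  · rw [hAV, key, symm]
  · rw [hAV, key, symm]

theorem exists_isPseudoinverse {k l : ℕ} (A : Matrix (Fin k) (Fin l) ℝ) :
    ∃ B : Matrix (Fin l) (Fin k) ℝ, IsPseudoinverse A B := by
  obtain ⟨C, hC, h⟩ := exists_isPseudoinverse_of_symm (Aᵀ * A)
    (by rw [Matrix.transpose_mul, Matrix.transpose_transpose])
  have hz : A * (C * (Aᵀ * A)) - A = 0 := by
    rw [← Matrix.conjTranspose_mul_self_eq_zero, Matrix.conjTranspose_eq_transpose_of_trivial]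
    have e : (A * (C * (Aᵀ * A)) - A) = A * (C * (Aᵀ * A) - 1) := by
      rw [Matrix.mul_sub, Matrix.mul_one]
    have e2 : Aᵀ * (A * (C * (Aᵀ * A) - 1)) = 0 := by
      rw [← Matrix.mul_assoc, Matrix.mul_sub, Matrix.mul_one, ← Matrix.mul_assoc (Aᵀ * A),
        h.mul_mul_self, sub_self]
    rw [e, Matrix.transpose_mul, Matrix.mul_assoc, e2, Matrix.mul_zero]
  have hz' : A * C * Aᵀ * A = A := by
    have := sub_eq_zero.mp hz
    simpa only [Matrix.mul_assoc] using this
  refine ⟨C * Aᵀ, ?_, ?_, ?_, ?_⟩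
  · simpa only [Matrix.mul_assoc] using hz'
  · have := congrArg (· * Aᵀ) h.mul_mul_inv
    simpa only [Matrix.mul_assoc] using this
  · simp only [Matrix.transpose_mul, Matrix.transpose_transpose, hC, Matrix.mul_assoc]
  · have := h.symm_right
    simpa only [Matrix.mul_assoc] using this

/-- The Moore–Penrose inverse `A†` of a real matrix: the unique solution of the four
Penrose equations. -/
noncomputable def pinv {k l : ℕ} (A : Matrix (Fin k) (Fin l) ℝ) : Matrix (Fin l) (Fin k) ℝ :=
  Classical.choose (exists_isPseudoinverse A)

theorem pinv_spec {k l : ℕ} (A : Matrix (Fin k) (Fin l) ℝ) : IsPseudoinverse A (pinv A) :=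
  Classical.choose_spec (exists_isPseudoinverse A)

/-- `v_Ω`: the observed entries of `v`, one for each sampled index (with multiplicity). -/
noncomputable def sampleVec {n m : ℕ} (v : EuclideanSpace ℝ (Fin n)) (Ω : Fin m → Fin n) :
    EuclideanSpace ℝ (Fin m) :=
  WithLp.toLp 2 (fun k => v (Ω k))

/-- `U_Ω`: the rows of `U`, one for each sampled index (with multiplicity). -/
def sampleRows {n m r : ℕ} (U : Matrix (Fin n) (Fin r) ℝ) (Ω : Fin m → Fin n) :
    Matrix (Fin m) (Fin r) ℝ :=
  fun k i => U (Ω k) i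

/-- `P_{S_Ω} w = U_Ω (U_Ωᵀ U_Ω)† U_Ωᵀ w`. -/
noncomputable def sampleProj {n m r : ℕ} (U : Matrix (Fin n) (Fin r) ℝ) (Ω : Fin m → Fin n)
    (w : EuclideanSpace ℝ (Fin m)) : EuclideanSpace ℝ (Fin m) :=
  WithLp.toLp 2 ((sampleRows U Ω * pinv ((sampleRows U Ω)ᵀ * sampleRows U Ω) *
    (sampleRows U Ω)ᵀ) *ᵥ w.ofLp)

/-! The operator `sampleProj U ω` is the orthogonal projection onto the sampled columns of `U`, and
the sample of `x` lies in their span. The residual therefore depends on `y` alone: it is the sample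
of `y - s` for some `s ∈ S`, and it is orthogonal to the sample of `S`. Pythagoras bounds its square
above by `∑ y (ω k) ^ 2` (`norm_sq_residual_le`). Completing a square bounds it below by `∑ y (ω k)
^ 2 - B ^ 2 / l` (`le_norm_sq_residual`), where `l` bounds `∑ s (ω k) ^ 2` from below on the unit
sphere of `S` and `B` bounds the norm of `∑ y (ω k) • P_S e_{ω k}`.

Four bad events remain, each of frequency at most `δ`. Hoeffding's inequality controls the two tails
of `∑ y (ω k) ^ 2`. McDiarmid's inequality controls the vector sum, whose terms are centred because
`P_S y = 0`. The matrix Chernoff bound controls `l`; it comes from the Ahlswede–Winter argument,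
which rests on the Golden–Thompson inequality.

Independence and uniformity enter once, in `measureReal_sample_eq_proportion`: afterwards every
probability is a plain average over `Fin m → Fin n`, and every induction on `m` peels off one
sample. -/

/-! ### Trace inequalities for powers, the Lie product formula and Golden–Thompson. -/

section GoldenThompson

variable {ι : Type*} [Fintype ι] [DecidableEq ι]

theorem Matrix.trace_mul_pow_comm (A B : Matrix ι ι ℝ) (p : ℕ) :
    ((A * B) ^ p).trace = ((B * A) ^ p).trace := by
  cases p with
  | zero => simp
  | succ p =>
    have h : ∀ q : ℕ, (A * B) ^ q * A = A * (B * A) ^ q := by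
      intro q
      induction q with
      | zero => simp
      | succ q ih =>
        rw [pow_succ, pow_succ, ← Matrix.mul_assoc A, ← ih]
        simp only [Matrix.mul_assoc]
    rw [pow_succ, ← Matrix.mul_assoc, h, Matrix.mul_assoc, Matrix.trace_mul_comm,
      Matrix.mul_assoc, ← pow_succ]

theorem Matrix.abs_trace_mul_le {ι : Type*} [Fintype ι] (A B : Matrix ι ι ℝ) :
    |(A * B).trace| ≤ ((A * Aᵀ).trace + (B * Bᵀ).trace) / 2 := by
  have h1 : (A * Aᵀ).trace = ∑ i, ∑ j, A i j ^ 2 := by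
    simp [Matrix.trace, Matrix.mul_apply, sq]
  have h2 : (B * Bᵀ).trace = ∑ i, ∑ j, B j i ^ 2 := by
    rw [Finset.sum_comm]
    simp [Matrix.trace, Matrix.mul_apply, sq]
  rw [h1, h2, ← Finset.sum_add_distrib, Finset.sum_div]
  simp only [Matrix.trace, Matrix.diag, Matrix.mul_apply]
  refine (Finset.abs_sum_le_sum_abs _ _).trans (Finset.sum_le_sum fun i _ => ?_)
  rw [← Finset.sum_add_distrib, Finset.sum_div]
  refine (Finset.abs_sum_le_sum_abs _ _).trans (Finset.sum_le_sum fun j _ => ?_)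
  rw [abs_le]
  constructor <;> nlinarith [sq_nonneg (A i j + B j i), sq_nonneg (A i j - B j i)]

/-- The two claims feed each other. For the first, `M ^ 2` in place of `M` produces the symmetric
factors `Mᵀ * M` and `M * Mᵀ`; the second claim separates them and `abs_trace_mul_le` merges the two
equal traces. For the second, the first claim with `M = A * B` reduces to `A ^ 2` and `B ^ 2` by
cyclicity of the trace. -/
theorem Matrix.trace_pow_two_pow_le (k : ℕ) :
    (∀ M : Matrix ι ι ℝ, |(M ^ 2 ^ (k + 1)).trace| ≤ ((M * Mᵀ) ^ 2 ^ k).trace) ∧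
    ∀ A B : Matrix ι ι ℝ, Aᵀ = A → Bᵀ = B →
      ((A * B) ^ 2 ^ k).trace ≤ (A ^ 2 ^ k * B ^ 2 ^ k).trace := by
  induction k with
  | zero =>
    refine ⟨fun M => ?_, fun A B _ _ => by simp⟩
    have := Matrix.abs_trace_mul_le M M
    simp only [zero_add, pow_one, pow_zero, sq]
    linarith
  | succ k ih =>
    obtain ⟨ih1, ih2⟩ := ih
    constructor
    · intro M
      have e1 : M ^ 2 ^ (k + 1 + 1) = (M * M) ^ 2 ^ (k + 1) := by
        rw [← sq, ← pow_mul, ← pow_succ']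
      have e2 : ((M * M * (M * M)ᵀ) ^ 2 ^ k).trace = ((Mᵀ * M * (M * Mᵀ)) ^ 2 ^ k).trace := by
        rw [Matrix.transpose_mul, ← Matrix.mul_assoc, Matrix.trace_mul_pow_comm]
        simp only [Matrix.mul_assoc]
      have h1 : (Mᵀ * M)ᵀ = Mᵀ * M := by simp
      have h2 : (M * Mᵀ)ᵀ = M * Mᵀ := by simp
      rw [e1]
      refine (ih1 _).trans ?_
      rw [e2]
      refine (ih2 _ _ h1 h2).trans ((le_abs_self _).trans ((Matrix.abs_trace_mul_le _ _).trans ?_))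
      rw [Matrix.transpose_pow, Matrix.transpose_pow, h1, h2, ← pow_add, ← pow_add, ← two_mul,
        ← pow_succ', Matrix.trace_mul_pow_comm Mᵀ M]
      linarith
    · intro A B hA hB
      have e : ((A * B * (A * B)ᵀ) ^ 2 ^ k).trace = ((A * A * (B * B)) ^ 2 ^ k).trace := by
        rw [Matrix.transpose_mul, hA, hB, ← Matrix.mul_assoc, Matrix.trace_mul_pow_comm]
        simp only [Matrix.mul_assoc]
      refine (le_abs_self _).trans ((ih1 _).trans ?_)
      rw [e]
      refine (ih2 _ _ (by simp [hA]) (by simp [hB])).trans (le_of_eq ?_)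
      rw [← sq, ← sq, ← pow_mul, ← pow_mul, ← pow_succ']

theorem NormedSpace.norm_exp_le_exp_norm {𝔸 : Type*} [NormedRing 𝔸] [NormOneClass 𝔸]
    [NormedAlgebra ℝ 𝔸] [CompleteSpace 𝔸] (c : 𝔸) : ‖NormedSpace.exp c‖ ≤ Real.exp ‖c‖ := by
  rw [NormedSpace.exp_eq_tsum ℝ]
  have h : HasSum (fun n : ℕ => (n.factorial : ℝ)⁻¹ * ‖c‖ ^ n) (Real.exp ‖c‖) := by
    rw [Real.exp_eq_exp_ℝ]
    simpa using NormedSpace.exp_series_hasSum_exp' (𝕂 := ℝ) ‖c‖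
  refine tsum_of_norm_bounded h fun n => ?_
  rw [norm_smul, Real.norm_of_nonneg (by positivity)]
  gcongr
  exact norm_pow_le _ _

/-- The Lie product formula along a subsequence of the natural numbers. -/
theorem NormedSpace.tendsto_exp_mul_exp_pow {𝔸 : Type*} [NormedRing 𝔸] [NormOneClass 𝔸]
    [NormedAlgebra ℝ 𝔸] [CompleteSpace 𝔸] (a b : 𝔸) :
    Filter.Tendsto
      (fun N : ℕ => (NormedSpace.exp ((N : ℝ)⁻¹ • a) * NormedSpace.exp ((N : ℝ)⁻¹ • b)) ^ N)
      Filter.atTop (nhds (NormedSpace.exp (a + b))) := by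
  let _ : NormedAlgebra ℚ 𝔸 := NormedAlgebra.restrictScalars ℚ ℝ 𝔸
  have telescope : ∀ (x y : 𝔸) (K : ℝ), 0 ≤ K → ‖x‖ ≤ K → ‖y‖ ≤ K → ∀ N : ℕ,
      ‖x ^ (N + 1) - y ^ (N + 1)‖ ≤ (N + 1) * K ^ N * ‖x - y‖ := by
    intro x y K hK hx hy N
    induction N with
    | zero => simp
    | succ N ih =>
      have e : x ^ (N + 1 + 1) - y ^ (N + 1 + 1)
          = x ^ (N + 1) * (x - y) + (x ^ (N + 1) - y ^ (N + 1)) * y := by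
        rw [pow_succ x (N + 1), pow_succ y (N + 1)]; noncomm_ring
      have h1 : ‖x ^ (N + 1)‖ ≤ K ^ (N + 1) :=
        (norm_pow_le _ _).trans (pow_le_pow_left₀ (norm_nonneg _) hx _)
      rw [e]
      calc _ ≤ ‖x ^ (N + 1)‖ * ‖x - y‖ + ‖x ^ (N + 1) - y ^ (N + 1)‖ * ‖y‖ :=
            (norm_add_le _ _).trans (add_le_add (norm_mul_le _ _) (norm_mul_le _ _))
        _ ≤ K ^ (N + 1) * ‖x - y‖ + ((N + 1) * K ^ N * ‖x - y‖) * K := by gcongr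
        _ = _ := by push_cast; ring
  -- `g` vanishes to first order at `0`, so `N * ‖g (1 / N)‖` tends to `0`; the telescoping estimate
  -- loses exactly a factor `N`, up to a constant.
  set g : ℝ → 𝔸 := fun t => NormedSpace.exp (t • (a + b))
    - NormedSpace.exp (t • a) * NormedSpace.exp (t • b)
  have hg : HasDerivAt g 0 0 := by
    have h := (hasDerivAt_exp_smul_const (𝕂 := ℝ) (a + b) 0).sub
      ((hasDerivAt_exp_smul_const (𝕂 := ℝ) a 0).mul (hasDerivAt_exp_smul_const (𝕂 := ℝ) b 0))
    refine (h.congr_deriv (by simp)).congr_of_eventuallyEq (Filter.Eventually.of_forall fun t => ?_)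
    simp [g]
  have hlim : Filter.Tendsto (fun N : ℕ => (N : ℝ) * ‖g ((N : ℝ)⁻¹)‖) Filter.atTop (nhds 0) := by
    have h := hg.tendsto_slope_zero
    have hN : Filter.Tendsto (fun N : ℕ => ((N : ℝ)⁻¹)) Filter.atTop (nhdsWithin 0 {0}ᶜ) := by
      refine tendsto_nhdsWithin_iff.2 ⟨tendsto_inv_atTop_nhds_zero_nat, ?_⟩
      filter_upwards [Filter.eventually_gt_atTop 0] with N hN
      simp [hN.ne']
    have h2 := (h.comp hN).norm
    simpa [g, Function.comp_def, norm_smul] using h2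
  have hexp : ∀ c : 𝔸, ‖NormedSpace.exp c‖ ≤ Real.exp ‖c‖ := NormedSpace.norm_exp_le_exp_norm
  have hdiff : Filter.Tendsto (fun N : ℕ => NormedSpace.exp (a + b) -
      (NormedSpace.exp ((N : ℝ)⁻¹ • a) * NormedSpace.exp ((N : ℝ)⁻¹ • b)) ^ N)
      Filter.atTop (nhds 0) := by
    refine squeeze_zero_norm' (a := fun N : ℕ => Real.exp (‖a‖ + ‖b‖) * (N * ‖g ((N : ℝ)⁻¹)‖))
      ?_ (by simpa using hlim.const_mul (Real.exp (‖a‖ + ‖b‖)))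
    filter_upwards [Filter.eventually_gt_atTop 0] with N hN
    obtain ⟨M, rfl⟩ : ∃ M, N = M + 1 := ⟨N - 1, by omega⟩
    have hpos : (0 : ℝ) < ((M + 1 : ℕ) : ℝ) := by positivity
    have e1 : NormedSpace.exp (a + b)
        = NormedSpace.exp (((M + 1 : ℕ) : ℝ)⁻¹ • (a + b)) ^ (M + 1) := by
      rw [← NormedSpace.exp_nsmul, ← Nat.cast_smul_eq_nsmul ℝ, smul_smul,
        mul_inv_cancel₀ hpos.ne', one_smul]
    set K := Real.exp (((M + 1 : ℕ) : ℝ)⁻¹ * (‖a‖ + ‖b‖)) with hK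
    have hKM : K ^ M ≤ Real.exp (‖a‖ + ‖b‖) := by
      rw [hK, ← Real.exp_nat_mul]
      refine Real.exp_le_exp.2 ?_
      rw [← mul_assoc]
      refine mul_le_of_le_one_left (by positivity) ?_
      rw [← div_eq_mul_inv, div_le_one hpos]
      push_cast; linarith
    have hn : ∀ c : 𝔸, ‖(((M + 1 : ℕ) : ℝ)⁻¹ • c)‖ = ((M + 1 : ℕ) : ℝ)⁻¹ * ‖c‖ := fun c => by
      rw [norm_smul, Real.norm_of_nonneg (by positivity)]
    have hx : ‖NormedSpace.exp (((M + 1 : ℕ) : ℝ)⁻¹ • (a + b))‖ ≤ K := by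
      refine (hexp _).trans (Real.exp_le_exp.2 ?_)
      rw [hn]
      gcongr
      exact norm_add_le _ _
    have hy : ‖NormedSpace.exp (((M + 1 : ℕ) : ℝ)⁻¹ • a) *
        NormedSpace.exp (((M + 1 : ℕ) : ℝ)⁻¹ • b)‖ ≤ K := by
      refine (norm_mul_le _ _).trans ?_
      rw [hK, mul_add, Real.exp_add, ← hn, ← hn]
      gcongr <;> exact hexp _
    rw [e1]
    refine (telescope _ _ K (Real.exp_nonneg _) hx hy M).trans ?_
    have : ((M : ℝ) + 1) * K ^ M * ‖g (((M + 1 : ℕ) : ℝ)⁻¹)‖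
        ≤ Real.exp (‖a‖ + ‖b‖) * (((M + 1 : ℕ) : ℝ) * ‖g (((M + 1 : ℕ) : ℝ)⁻¹)‖) := by
      push_cast
      rw [mul_comm ((M : ℝ) + 1), mul_assoc]
      gcongr
    exact this
  simpa using (tendsto_const_nhds (x := NormedSpace.exp (a + b))).sub hdiff

open scoped Matrix.Norms.Operator in
/-- The Golden–Thompson inequality for real symmetric matrices. -/
theorem Matrix.trace_exp_add_le (A B : Matrix ι ι ℝ) (hA : Aᵀ = A) (hB : Bᵀ = B) :
    (NormedSpace.exp (A + B)).trace ≤ (NormedSpace.exp A * NormedSpace.exp B).trace := by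
  cases isEmpty_or_nonempty ι
  · simp [Matrix.trace]
  -- Restricting to `N = 2 ^ k` makes `trace_pow_two_pow_le` applicable, and its right side does not
  -- depend on `k`.
  have h := (NormedSpace.tendsto_exp_mul_exp_pow A B).comp
    (tendsto_pow_atTop_atTop_of_one_lt (one_lt_two : (1 : ℕ) < 2))
  have ht : Continuous fun M : Matrix ι ι ℝ => M.trace := continuous_id.matrix_trace
  refine le_of_tendsto ((ht.tendsto _).comp h) (Filter.Eventually.of_forall fun k => ?_)
  have hs : ∀ C : Matrix ι ι ℝ, Cᵀ = C →
      (NormedSpace.exp ((((2 ^ k : ℕ) : ℝ))⁻¹ • C))ᵀ = NormedSpace.exp ((((2 ^ k : ℕ) : ℝ))⁻¹ • C) := by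
    intro C hC
    rw [← Matrix.exp_transpose, Matrix.transpose_smul, hC]
  have hp : ∀ C : Matrix ι ι ℝ,
      NormedSpace.exp ((((2 ^ k : ℕ) : ℝ))⁻¹ • C) ^ 2 ^ k = NormedSpace.exp C := by
    intro C
    rw [← Matrix.exp_nsmul, ← Nat.cast_smul_eq_nsmul ℝ, smul_smul, mul_inv_cancel₀ (by positivity),
      one_smul]
  have := (Matrix.trace_pow_two_pow_le k).2 _ _ (hs A hA) (hs B hB)
  rwa [hp, hp] at this

end GoldenThompson

/-! ### Loewner-order bounds for the exponential of a symmetric matrix. -/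

section ExpPosSemidef

variable {ι : Type*} [Fintype ι] [DecidableEq ι]

theorem Matrix.exists_orthogonal_diagonal (A : Matrix ι ι ℝ) (hA : Aᵀ = A) :
    ∃ (V : Matrix ι ι ℝ) (d : ι → ℝ), Vᵀ * V = 1 ∧ V * Vᵀ = 1 ∧
      A = V * Matrix.diagonal d * Vᵀ := by
  have hH : A.IsHermitian := by
    rw [Matrix.IsHermitian, Matrix.conjTranspose_eq_transpose_of_trivial, hA]
  refine ⟨hH.eigenvectorUnitary, hH.eigenvalues, ?_, ?_, ?_⟩
  · have := Unitary.coe_star_mul_self hH.eigenvectorUnitary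
    simpa [Matrix.star_eq_conjTranspose, Matrix.conjTranspose_eq_transpose_of_trivial] using this
  · have := Unitary.coe_mul_star_self hH.eigenvectorUnitary
    simpa [Matrix.star_eq_conjTranspose, Matrix.conjTranspose_eq_transpose_of_trivial] using this
  · have := hH.spectral_theorem
    simpa [Unitary.conjStarAlgAut_apply, Matrix.star_eq_conjTranspose,
      Matrix.conjTranspose_eq_transpose_of_trivial, Function.comp_def] using this

theorem Matrix.exp_orthogonal_diagonal (V : Matrix ι ι ℝ) (d : ι → ℝ) (h : Vᵀ * V = 1)
    (h' : V * Vᵀ = 1) (c : ℝ) :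
    NormedSpace.exp (c • (V * Matrix.diagonal d * Vᵀ))
      = V * Matrix.diagonal (fun i => Real.exp (c * d i)) * Vᵀ := by
  have hinv : V⁻¹ = Vᵀ := Matrix.inv_eq_right_inv h'
  have hu : IsUnit V := ⟨⟨V, Vᵀ, h', h⟩, rfl⟩
  have e : c • (V * Matrix.diagonal d * Vᵀ) = V * Matrix.diagonal (c • d) * V⁻¹ := by
    rw [hinv, Matrix.diagonal_smul, Matrix.mul_smul, Matrix.smul_mul]
  rw [e, Matrix.exp_conj V _ hu, Matrix.exp_diagonal, hinv]
  congr 3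
  funext i
  rw [Pi.coe_exp]
  simp [Real.exp_eq_exp_ℝ]

theorem Matrix.posSemidef_orthogonal_diagonal (V : Matrix ι ι ℝ) (d : ι → ℝ)
    (hd : ∀ i, 0 ≤ d i) : (V * Matrix.diagonal d * Vᵀ).PosSemidef := by
  have := (Matrix.PosSemidef.diagonal (n := ι) (d := d) hd).mul_mul_conjTranspose_same V
  rwa [Matrix.conjTranspose_eq_transpose_of_trivial] at this

theorem Matrix.posSemidef_exp (A : Matrix ι ι ℝ) (hA : Aᵀ = A) :
    (NormedSpace.exp A).PosSemidef := by
  obtain ⟨V, d, h, h', rfl⟩ := A.exists_orthogonal_diagonal hA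
  rw [← one_smul ℝ (V * Matrix.diagonal d * Vᵀ), Matrix.exp_orthogonal_diagonal V d h h']
  exact Matrix.posSemidef_orthogonal_diagonal _ _ fun i => (Real.exp_pos _).le

theorem Matrix.posSemidef_exp_sub (A : Matrix ι ι ℝ) (hA : Aᵀ = A) :
    (NormedSpace.exp A - (1 + A)).PosSemidef := by
  obtain ⟨V, d, h, h', rfl⟩ := A.exists_orthogonal_diagonal hA
  have e : NormedSpace.exp (V * Matrix.diagonal d * Vᵀ) - (1 + V * Matrix.diagonal d * Vᵀ)
      = V * Matrix.diagonal (fun i => Real.exp (1 * d i) - (1 + d i)) * Vᵀ := by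
    nth_rewrite 1 [← one_smul ℝ (V * Matrix.diagonal d * Vᵀ)]
    rw [Matrix.exp_orthogonal_diagonal V d h h', ← Matrix.diagonal_sub, ← Matrix.diagonal_add,
      Matrix.mul_sub, Matrix.mul_add, Matrix.diagonal_one, Matrix.sub_mul, Matrix.add_mul,
      Matrix.mul_one, h']
  rw [e]
  refine Matrix.posSemidef_orthogonal_diagonal _ _ fun i => ?_
  rw [one_mul]
  linarith [Real.add_one_le_exp (d i)]

theorem Matrix.PosSemidef.exists_orthogonal_diagonal {A : Matrix ι ι ℝ} (hA : A.PosSemidef) :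
    ∃ (V : Matrix ι ι ℝ) (d : ι → ℝ), (∀ i, 0 ≤ d i) ∧ Vᵀ * A * V = Matrix.diagonal d ∧
      Vᵀ * V = 1 ∧ V * Vᵀ = 1 ∧ A = V * Matrix.diagonal d * Vᵀ := by
  have hsymm : Aᵀ = A := by
    rw [← Matrix.conjTranspose_eq_transpose_of_trivial]; exact hA.isHermitian
  obtain ⟨V, d, h, h', rfl⟩ := A.exists_orthogonal_diagonal hsymm
  have hD : Vᵀ * (V * Matrix.diagonal d * Vᵀ) * V = Matrix.diagonal d := by
    calc _ = (Vᵀ * V) * Matrix.diagonal d * (Vᵀ * V) := by simp only [Matrix.mul_assoc]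
      _ = _ := by rw [h, Matrix.one_mul, Matrix.mul_one]
  refine ⟨V, d, fun i => ?_, hD, h, h', rfl⟩
  have := hA.conjTranspose_mul_mul_same V
  rw [Matrix.conjTranspose_eq_transpose_of_trivial, hD] at this
  simpa using this.diag_nonneg (i := i)

/-- The chord of `t ↦ exp (-θ t)` on `[0, R]` bounds the exponential of a matrix whose spectrum lies
in that interval. -/
theorem Matrix.posSemidef_sub_exp_neg_smul (A : Matrix ι ι ℝ) {R : ℝ} (θ : ℝ) (hR : 0 < R)
    (hA : A.PosSemidef) (hAR : (R • (1 : Matrix ι ι ℝ) - A).PosSemidef) :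
    (1 - ((1 - Real.exp (-θ * R)) / R) • A - NormedSpace.exp ((-θ) • A)).PosSemidef := by
  obtain ⟨V, d, hd0, hD, h, h', rfl⟩ := hA.exists_orthogonal_diagonal
  set κ := (1 - Real.exp (-θ * R)) / R with hκ
  have hdR : ∀ i, d i ≤ R := fun i => by
    have := (hAR.conjTranspose_mul_mul_same V).diag_nonneg (i := i)
    rw [Matrix.conjTranspose_eq_transpose_of_trivial, Matrix.mul_sub, Matrix.sub_mul, hD, Matrix.mul_smul, Matrix.mul_one, Matrix.smul_mul, h] at this
    simpa using this
  have e : 1 - κ • (V * Matrix.diagonal d * Vᵀ) - NormedSpace.exp ((-θ) • (V * Matrix.diagonal d * Vᵀ))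
      = V * Matrix.diagonal (fun i => 1 - κ * d i - Real.exp (-θ * d i)) * Vᵀ := by
    have e1 : Matrix.diagonal (fun i => κ * d i) = κ • Matrix.diagonal d := by
      rw [← Matrix.diagonal_smul]; rfl
    rw [Matrix.exp_orthogonal_diagonal V d h h', ← Matrix.diagonal_sub, ← Matrix.diagonal_sub,
      Matrix.mul_sub, Matrix.mul_sub, Matrix.diagonal_one, Matrix.sub_mul, Matrix.sub_mul,
      Matrix.mul_one, h', e1, Matrix.mul_smul, Matrix.smul_mul]
  rw [e]
  refine Matrix.posSemidef_orthogonal_diagonal _ _ fun i => ?_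
  have h1 : 0 ≤ 1 - d i / R := by linarith [(div_le_one hR).2 (hdR i)]
  have hc := convexOn_exp.2 (Set.mem_univ (0 : ℝ)) (Set.mem_univ (-θ * R)) h1
    (div_nonneg (hd0 i) hR.le) (by ring)
  simp only [smul_eq_mul, mul_zero, zero_add, Real.exp_zero, mul_one] at hc
  have e2 : d i / R * (-θ * R) = -θ * d i := by field_simp
  rw [e2] at hc
  have e3 : κ * d i = d i / R - d i / R * Real.exp (-θ * R) := by rw [hκ]; ring
  linarith

theorem Matrix.trace_mul_nonneg_of_posSemidef {A B : Matrix ι ι ℝ} (hA : A.PosSemidef)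
    (hB : B.PosSemidef) : 0 ≤ (A * B).trace := by
  obtain ⟨V, d, hd, -, h, -, rfl⟩ := hA.exists_orthogonal_diagonal
  have e : (V * Matrix.diagonal d * Vᵀ * B).trace
      = ∑ i, d i * (Vᵀ * B * V) i i := by
    rw [Matrix.mul_assoc, Matrix.mul_assoc, Matrix.trace_mul_comm, Matrix.mul_assoc]
    simp [Matrix.trace]
  rw [e]
  have := hB.conjTranspose_mul_mul_same V
  rw [Matrix.conjTranspose_eq_transpose_of_trivial] at this
  exact Finset.sum_nonneg fun i _ => mul_nonneg (hd i) this.diag_nonneg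

/-- The complementary projection `1 - c cᵀ` is positive semidefinite, so its product with `A` has
nonnegative trace. -/
theorem Matrix.dotProduct_mulVec_le_trace {A : Matrix ι ι ℝ} (hA : A.PosSemidef) (c : ι → ℝ)
    (hc : c ⬝ᵥ c = 1) : c ⬝ᵥ A *ᵥ c ≤ A.trace := by
  have hP : (1 - Matrix.vecMulVec c c).PosSemidef := by
    have hs : (1 - Matrix.vecMulVec c c)ᵀ = 1 - Matrix.vecMulVec c c := by
      rw [Matrix.transpose_sub, Matrix.transpose_one, Matrix.transpose_vecMulVec]
    have hi : (1 - Matrix.vecMulVec c c) * (1 - Matrix.vecMulVec c c)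
        = 1 - Matrix.vecMulVec c c := by
      have : Matrix.vecMulVec c c * Matrix.vecMulVec c c = Matrix.vecMulVec c c := by
        rw [Matrix.vecMulVec_mul_vecMulVec, hc]; simp
      rw [Matrix.mul_sub, Matrix.sub_mul, Matrix.sub_mul, this]; simp
    have := Matrix.posSemidef_conjTranspose_mul_self (1 - Matrix.vecMulVec c c)
    rwa [Matrix.conjTranspose_eq_transpose_of_trivial, hs, hi] at this
  have := Matrix.trace_mul_nonneg_of_posSemidef hA hP
  rw [Matrix.mul_sub, Matrix.mul_one, Matrix.trace_sub, Matrix.mul_vecMulVec,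
    Matrix.trace_vecMulVec, dotProduct_comm] at this
  linarith

/-- If a quadratic form takes a value below `λ` on a unit vector, then the trace exponential of
`-θ (A - λ)` is at least one. -/
theorem Matrix.one_le_exp_mul_trace_exp {A : Matrix ι ι ℝ} (hA : Aᵀ = A) {θ l : ℝ} (hθ : 0 ≤ θ)
    (c : ι → ℝ) (hc : c ⬝ᵥ c = 1) (hl : c ⬝ᵥ A *ᵥ c ≤ l) :
    1 ≤ Real.exp (θ * l) * (NormedSpace.exp ((-θ) • A)).trace := by
  have hs : ((-θ) • A)ᵀ = (-θ) • A := by rw [Matrix.transpose_smul, hA]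
  have h1 := Matrix.dotProduct_mulVec_le_trace (Matrix.posSemidef_exp _ hs) c hc
  obtain ⟨V, d, h, h', rfl⟩ := A.exists_orthogonal_diagonal hA
  set A := V * Matrix.diagonal d * Vᵀ
  -- After the shift by `l`, the bound `exp ≥ 1 + id` in direction `c` gives at least `1 - θ (cᵀ A c
  -- - l) ≥ 1`.
  have h2 : Real.exp (-(θ * l)) ≤ c ⬝ᵥ NormedSpace.exp ((-θ) • A) *ᵥ c := by
    have hB : ((-θ) • (A - l • (1 : Matrix ι ι ℝ)))ᵀ = (-θ) • (A - l • (1 : Matrix ι ι ℝ)) := by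
      rw [Matrix.transpose_smul, Matrix.transpose_sub, hA]; simp
    have e : NormedSpace.exp ((-θ) • A) =
        Real.exp (-(θ * l)) • NormedSpace.exp ((-θ) • (A - l • (1 : Matrix ι ι ℝ))) := by
      have e1 : A - l • (1 : Matrix ι ι ℝ) = V * Matrix.diagonal (fun i => d i - l) * Vᵀ := by
        have : Matrix.diagonal (fun _ : ι => l) = l • (1 : Matrix ι ι ℝ) := by
          ext i j; simp [Matrix.diagonal_apply, Matrix.one_apply]
        rw [← Matrix.diagonal_sub, Matrix.mul_sub, Matrix.sub_mul, this, Matrix.mul_smul,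
          Matrix.smul_mul, Matrix.mul_one, h']
      rw [e1, Matrix.exp_orthogonal_diagonal V d h h', Matrix.exp_orthogonal_diagonal V _ h h',
        ← Matrix.smul_mul, ← Matrix.mul_smul, ← Matrix.diagonal_smul]
      congr 3
      funext i
      simp only [Pi.smul_apply, smul_eq_mul, ← Real.exp_add]
      congr 1; ring
    have hp := (Matrix.posSemidef_exp_sub _ hB).dotProduct_mulVec_nonneg c
    rw [star_trivial, Matrix.sub_mulVec, Matrix.add_mulVec, Matrix.one_mulVec, Matrix.smul_mulVec,
      Matrix.sub_mulVec, Matrix.smul_mulVec, Matrix.one_mulVec, dotProduct_sub, dotProduct_add,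
      dotProduct_smul, dotProduct_sub, dotProduct_smul, hc] at hp
    rw [e, Matrix.smul_mulVec, dotProduct_smul, smul_eq_mul]
    refine le_mul_of_one_le_right (Real.exp_nonneg _) ?_
    simp only [smul_eq_mul] at hp
    nlinarith
  have h3 := h2.trans h1
  calc (1 : ℝ) = Real.exp (θ * l) * Real.exp (-(θ * l)) := by rw [← Real.exp_add]; simp
    _ ≤ _ := by gcongr

end ExpPosSemidef

/-! ### Exponential moments of uniform samples: McDiarmid and matrix Chernoff. -/

section Averages
open scoped BigOperators

theorem Fintype.expect_fin_succ {ι : Type*} [Fintype ι] [Nonempty ι] {m : ℕ}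
    (F : (Fin (m + 1) → ι) → ℝ) :
    𝔼 ω, F ω = 𝔼 j, 𝔼 ω, F (Fin.cons j ω) := by
  rw [← Fintype.expect_equiv (Fin.consEquiv fun _ => ι) (fun p => F (Fin.cons p.1 p.2)) F
    (fun p => rfl), ← Finset.univ_product_univ, Finset.expect_product]

/-- **Hoeffding's lemma** for the uniform distribution on a finite type. -/
theorem Fintype.expect_exp_le_of_abs_sub_le {ι : Type*} [Fintype ι] [Nonempty ι] (g : ι → ℝ)
    {c : ℝ} (hg : ∀ i j, |g i - g j| ≤ c) (s : ℝ) :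
    𝔼 i, Real.exp (s * (g i - 𝔼 j, g j)) ≤ Real.exp (s ^ 2 * c ^ 2 / 8) := by
  classical
  let _ : MeasurableSpace ι := ⊤
  have : MeasurableSingletonClass ι := ⟨fun _ => trivial⟩
  set μ : Measure ι := uniformOn Set.univ
  have : IsProbabilityMeasure μ := isProbabilityMeasure_uniformOn Set.finite_univ Set.univ_nonempty
  have hint : ∀ F : ι → ℝ, ∫ i, F i ∂μ = 𝔼 i, F i := by
    intro F
    rw [integral_fintype (Integrable.of_finite), Fintype.expect_eq_sum_div_card, Finset.sum_div]
    refine Finset.sum_congr rfl fun i _ => ?_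
    rw [measureReal_def, uniformOn_univ]
    simp [div_eq_inv_mul]
  obtain ⟨i₀, hi₀⟩ := Finite.exists_min g
  have h := hasSubgaussianMGF_of_mem_Icc (μ := μ) (X := g) (a := g i₀) (b := g i₀ + c)
    (measurable_of_finite g).aemeasurable (Filter.Eventually.of_forall fun i =>
      ⟨hi₀ i, by linarith [(abs_le.1 (hg i i₀)).2]⟩)
  have := h.mgf_le s
  rw [mgf, hint, hint] at this
  refine this.trans (Real.exp_le_exp.2 (le_of_eq ?_))
  have hc : 0 ≤ c := (abs_nonneg _).trans (hg i₀ i₀)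
  simp [abs_of_nonneg hc]
  ring

/-- The exponential moment bound behind **McDiarmid's inequality**. -/
theorem Fintype.expect_exp_le_of_bounded_differences {ι : Type*} [Fintype ι] [Nonempty ι] {m : ℕ}
    (f : (Fin m → ι) → ℝ) {c : ℝ}
    (hf : ∀ ω k j, |f (Function.update ω k j) - f ω| ≤ c) (s : ℝ) :
    𝔼 ω, Real.exp (s * (f ω - 𝔼 ω, f ω)) ≤ Real.exp (m * (s ^ 2 * c ^ 2 / 8)) := by
  classical
  induction m with
  | zero => simp
  | succ m ih =>
    -- `g` is the conditional mean given the first sample. The deviation splits as `(f - g) + (g - 𝔼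
    -- g)`: the induction hypothesis treats the first term with that sample frozen, Hoeffding's
    -- lemma the second.
    set g : ι → ℝ := fun j => 𝔼 ω : Fin m → ι, f (Fin.cons j ω)
    have hg : ∀ i j, |g i - g j| ≤ c := by
      intro i j
      have hij : ∀ ω : Fin m → ι, |f (Fin.cons i ω) - f (Fin.cons j ω)| ≤ c := by
        intro ω
        have := hf (Fin.cons j ω) 0 i
        rwa [Fin.update_cons_zero] at this
      simp only [g]
      rw [← Finset.expect_sub_distrib]
      refine (Finset.abs_expect_le _ _).trans ?_
      exact Finset.expect_le Finset.univ_nonempty fun ω _ => hij ω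
    rw [Fintype.expect_fin_succ, Fintype.expect_fin_succ f]
    calc 𝔼 j, 𝔼 ω : Fin m → ι, Real.exp (s * (f (Fin.cons j ω) - 𝔼 j, g j))
        = 𝔼 j, Real.exp (s * (g j - 𝔼 j, g j)) *
            𝔼 ω : Fin m → ι, Real.exp (s * (f (Fin.cons j ω) - g j)) := by
          refine Finset.expect_congr rfl fun j _ => ?_
          rw [Finset.mul_expect]
          refine Finset.expect_congr rfl fun ω _ => ?_
          rw [← Real.exp_add]
          congr 1; ring
      _ ≤ 𝔼 j, Real.exp (s * (g j - 𝔼 j, g j)) * Real.exp (m * (s ^ 2 * c ^ 2 / 8)) := by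
          refine Finset.expect_le_expect fun j _ => ?_
          refine mul_le_mul_of_nonneg_left (ih (fun ω => f (Fin.cons j ω)) fun ω k i => ?_)
            (Real.exp_nonneg _)
          have := hf (Fin.cons j ω) k.succ i
          rwa [← Fin.cons_update] at this
      _ ≤ Real.exp (s ^ 2 * c ^ 2 / 8) * Real.exp (m * (s ^ 2 * c ^ 2 / 8)) := by
          rw [← Finset.expect_mul]
          exact mul_le_mul_of_nonneg_right (Fintype.expect_exp_le_of_abs_sub_le g hg s)
            (Real.exp_nonneg _)
      _ = _ := by rw [← Real.exp_add]; push_cast; congr 1; ring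

/-- The proportion of the points of a finite type that have the property `p`. -/
noncomputable def proportion {α : Type*} [Fintype α] (p : α → Prop) : ℝ :=
  𝔼 a, Set.indicator {a | p a} 1 a

theorem proportion_le_expect {α : Type*} [Fintype α] {p : α → Prop} {F : α → ℝ}
    (h0 : ∀ a, 0 ≤ F a) (h1 : ∀ a, p a → 1 ≤ F a) : proportion p ≤ 𝔼 a, F a := by
  refine Finset.expect_le_expect fun a _ => ?_
  by_cases h : p a
  · simpa [Set.indicator, h] using h1 a h
  · simpa [Set.indicator, h] using h0 a

theorem proportion_or_le {α : Type*} [Fintype α] (p q : α → Prop) :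
    proportion (fun a => p a ∨ q a) ≤ proportion p + proportion q := by
  unfold proportion
  rw [← Finset.expect_add_distrib]
  refine Finset.expect_le_expect fun a _ => ?_
  by_cases hp : p a <;> by_cases hq : q a <;> simp [Set.indicator, hp, hq]

/-- **McDiarmid's inequality** for independent uniform samples from a finite type. -/
theorem proportion_le_of_bounded_differences {ι : Type*} [Fintype ι] [Nonempty ι] {m : ℕ}
    (f : (Fin m → ι) → ℝ) {c t : ℝ} (hm : 0 < m) (hc : 0 < c) (ht : 0 ≤ t)
    (hf : ∀ ω k j, |f (Function.update ω k j) - f ω| ≤ c) :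
    proportion (fun ω => 𝔼 ω, f ω + t ≤ f ω) ≤ Real.exp (-(2 * t ^ 2 / (m * c ^ 2))) := by
  have hm' : (0 : ℝ) < m := by exact_mod_cast hm
  -- The minimiser of `-s t + m s² c² / 8`.
  set s := 4 * t / (m * c ^ 2) with hs
  have hs0 : 0 ≤ s := by positivity
  calc proportion (fun ω => 𝔼 ω, f ω + t ≤ f ω)
      ≤ 𝔼 ω, Real.exp (-(s * t)) * Real.exp (s * (f ω - 𝔼 ω, f ω)) := by
        refine proportion_le_expect (fun ω => by positivity) fun ω hω => ?_
        rw [← Real.exp_add]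
        refine Real.one_le_exp ?_
        nlinarith
    _ ≤ Real.exp (-(s * t)) * Real.exp (m * (s ^ 2 * c ^ 2 / 8)) := by
        rw [← Finset.mul_expect]
        gcongr
        exact Fintype.expect_exp_le_of_bounded_differences f hf s
    _ = _ := by
        rw [← Real.exp_add, hs]
        congr 1
        field_simp
        ring

/-- The Ahlswede–Winter bound for the trace exponential of a sum of independent uniform samples
from a family of matrices that adds up to the identity. -/
theorem Matrix.expect_trace_exp_le {ι κ : Type*} [Fintype ι] [Nonempty ι] [Fintype κ]
    [DecidableEq κ] (X : ι → Matrix κ κ ℝ) {R : ℝ} (θ : ℝ) (hR : 0 < R)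
    (hX : ∀ j, (X j).PosSemidef) (hXR : ∀ j, (R • (1 : Matrix κ κ ℝ) - X j).PosSemidef)
    (hsum : ∑ j, X j = 1) (m : ℕ) (H : Matrix κ κ ℝ) (hH : Hᵀ = H) :
    𝔼 ω : Fin m → ι, (NormedSpace.exp (H + (-θ) • ∑ k, X (ω k))).trace
      ≤ Real.exp (-(m * ((1 - Real.exp (-θ * R)) / R / Fintype.card ι)))
        * (NormedSpace.exp H).trace := by
  have hXs : ∀ j, (X j)ᵀ = X j := fun j => by
    rw [← Matrix.conjTranspose_eq_transpose_of_trivial]; exact (hX j).isHermitian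
  set q := (1 - Real.exp (-θ * R)) / R with hq
  -- Golden–Thompson detaches one sample from `H`, and the chord bound makes the trace affine in `X
  -- j`, so that averaging over `j` only involves `∑ X j = 1`. Leaving `H` arbitrary lets the
  -- induction absorb each sample into it.
  have step : ∀ H : Matrix κ κ ℝ, Hᵀ = H →
      𝔼 j, (NormedSpace.exp (H + (-θ) • X j)).trace
        ≤ Real.exp (-(q / Fintype.card ι)) * (NormedSpace.exp H).trace := by
    intro H hH
    have hpos := Matrix.posSemidef_exp H hH
    calc 𝔼 j, (NormedSpace.exp (H + (-θ) • X j)).trace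
        ≤ 𝔼 j, ((NormedSpace.exp H).trace - q * (NormedSpace.exp H * X j).trace) := by
          refine Finset.expect_le_expect fun j _ => ?_
          refine (Matrix.trace_exp_add_le H ((-θ) • X j) hH
            (by rw [Matrix.transpose_smul, hXs])).trans ?_
          have := Matrix.trace_mul_nonneg_of_posSemidef hpos
            (Matrix.posSemidef_sub_exp_neg_smul (X j) θ hR (hX j) (hXR j))
          rw [Matrix.mul_sub, Matrix.mul_sub, Matrix.mul_one, Matrix.trace_sub, Matrix.trace_sub,
            Matrix.mul_smul, Matrix.trace_smul, smul_eq_mul] at this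
          linarith
      _ = (NormedSpace.exp H).trace - q / Fintype.card ι * (NormedSpace.exp H).trace := by
          rw [Finset.expect_sub_distrib, Fintype.expect_const, ← Finset.mul_expect,
            Fintype.expect_eq_sum_div_card, ← Matrix.trace_sum, ← Matrix.mul_sum, hsum,
            Matrix.mul_one]
          ring
      _ ≤ _ := by
          have := Real.add_one_le_exp (-(q / Fintype.card ι))
          nlinarith [hpos.trace_nonneg]
  induction m generalizing H with
  | zero => simp
  | succ m ih =>
    rw [Fintype.expect_fin_succ]
    simp only [Fin.sum_univ_succ, Fin.cons_zero, Fin.cons_succ, smul_add, ← add_assoc]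
    calc _ ≤ 𝔼 j, Real.exp (-(m * (q / Fintype.card ι)))
          * (NormedSpace.exp (H + (-θ) • X j)).trace :=
          Finset.expect_le_expect fun j _ => ih _ (by
            rw [Matrix.transpose_add, Matrix.transpose_smul, hXs, hH])
      _ ≤ Real.exp (-(m * (q / Fintype.card ι))) * (Real.exp (-(q / Fintype.card ι))
          * (NormedSpace.exp H).trace) := by
          rw [← Finset.mul_expect]
          gcongr
          exact step H hH
      _ = _ := by
          rw [← mul_assoc, ← Real.exp_add]; push_cast; congr 2; ring

/-- `(1 + t + t² / 2) (1 - t + t² / 2) = 1 + t⁴ / 4 ≥ 1`, and the first factor is at most `exp t`.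
-/
theorem Real.exp_neg_le_quadratic {t : ℝ} (ht : 0 ≤ t) :
    Real.exp (-t) ≤ 1 - t + t ^ 2 / 2 := by
  have h := Real.quadratic_le_exp_of_nonneg ht
  have hp : 0 < 1 - t + t ^ 2 / 2 := by nlinarith [sq_nonneg (t - 1)]
  rw [Real.exp_neg, inv_le_comm₀ (Real.exp_pos _) hp]
  refine le_trans ?_ h
  rw [inv_le_iff_one_le_mul₀ hp]
  nlinarith [sq_nonneg (t ^ 2)]

/-- The lower tail of the **matrix Chernoff inequality**. -/
theorem Matrix.proportion_exists_dotProduct_mulVec_le {ι κ : Type*} [Fintype ι] [Nonempty ι]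
    [Fintype κ] [DecidableEq κ] (X : ι → Matrix κ κ ℝ) {R γ : ℝ} (hR : 0 < R) (hγ : 0 ≤ γ)
    (hX : ∀ j, (X j).PosSemidef) (hXR : ∀ j, (R • (1 : Matrix κ κ ℝ) - X j).PosSemidef)
    (hsum : ∑ j, X j = 1) (m : ℕ) :
    proportion (fun ω : Fin m → ι => ∃ c : κ → ℝ, c ⬝ᵥ c = 1 ∧
        c ⬝ᵥ (∑ k, X (ω k)) *ᵥ c ≤ (1 - γ) * (m / Fintype.card ι))
      ≤ Fintype.card κ * Real.exp (-(γ ^ 2 / 2 * (m / (Fintype.card ι * R)))) := by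
  have hXs : ∀ j, (X j)ᵀ = X j := fun j => by
    rw [← Matrix.conjTranspose_eq_transpose_of_trivial]; exact (hX j).isHermitian
  have hn : (0 : ℝ) < Fintype.card ι := by exact_mod_cast Fintype.card_pos
  set N : ℝ := (Fintype.card ι : ℝ)
  -- The optimal choice is `-log (1 - γ) / R`; this simpler one needs no `γ < 1` and already yields
  -- the exponent `γ² / 2`.
  set θ := γ / R with hθ
  have hθ0 : 0 ≤ θ := by positivity
  have hsymm : ∀ ω : Fin m → ι, (∑ k, X (ω k))ᵀ = ∑ k, X (ω k) := fun ω => by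
    rw [Matrix.transpose_sum]; simp only [hXs]
  have hE := Matrix.expect_trace_exp_le X θ hR hX hXR hsum m 0 (by simp)
  have htr : (NormedSpace.exp (0 : Matrix κ κ ℝ)).trace = Fintype.card κ := by simp
  simp only [zero_add, htr] at hE
  calc _ ≤ 𝔼 ω : Fin m → ι, Real.exp (θ * ((1 - γ) * (m / N)))
        * (NormedSpace.exp ((-θ) • ∑ k, X (ω k))).trace := by
        refine proportion_le_expect (fun ω => ?_) ?_
        · refine mul_nonneg (Real.exp_nonneg _) (Matrix.posSemidef_exp _ ?_).trace_nonneg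
          rw [Matrix.transpose_smul, hsymm]
        · rintro ω ⟨c, hc, hl⟩
          exact Matrix.one_le_exp_mul_trace_exp (hsymm ω) hθ0 c hc hl
    _ ≤ Real.exp (θ * ((1 - γ) * (m / N))) *
        (Real.exp (-(m * ((1 - Real.exp (-θ * R)) / R / N))) * Fintype.card κ) := by
        rw [← Finset.mul_expect]
        gcongr
    _ ≤ _ := by
        rw [← mul_assoc, ← Real.exp_add, mul_comm]
        gcongr
        have e1 : -θ * R = -γ := by rw [hθ]; field_simp
        rw [e1]
        have e2 : θ * ((1 - γ) * (m / N)) + -(m * ((1 - Real.exp (-γ)) / R / N))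
            = (γ * (1 - γ) - (1 - Real.exp (-γ))) * (m / (N * R)) := by
          rw [hθ]; field_simp; ring
        rw [e2, ← neg_mul]
        refine mul_le_mul_of_nonneg_right ?_ (by positivity)
        nlinarith [Real.exp_neg_le_quadratic hγ]

end Averages

/-! ### Sums over a sample, and passage from probabilities to proportions. -/

section SampleSums
open scoped BigOperators

theorem sum_update_sample_sub {ι V : Type*} [AddCommGroup V] {m : ℕ} (z : ι → V) (ω : Fin m → ι)
    (k : Fin m) (j : ι) :
    ∑ l, z (Function.update ω k j l) - ∑ l, z (ω l) = z j - z (ω k) := by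
  rw [← Finset.sum_sub_distrib, Finset.sum_eq_single k]
  · simp
  · intro l _ hl; simp [Function.update_of_ne hl]
  · simp

theorem expect_sum_sample {ι : Type*} [Fintype ι] [Nonempty ι] (m : ℕ) (g : ι → ℝ) :
    𝔼 ω : Fin m → ι, ∑ k, g (ω k) = m * 𝔼 j, g j := by
  induction m with
  | zero => simp
  | succ m ih =>
    rw [Fintype.expect_fin_succ]
    simp only [Fin.sum_univ_succ, Fin.cons_zero, Fin.cons_succ, Finset.expect_add_distrib, ih,
      Fintype.expect_const]
    push_cast; ring

/-- Independent centred vectors are orthogonal in mean: averaging over the first sample before the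
others kills the cross term. -/
theorem expect_norm_sq_sum_sample {ι V : Type*} [Fintype ι] [Nonempty ι] [NormedAddCommGroup V]
    [InnerProductSpace ℝ V] (m : ℕ) (z : ι → V) (hz : ∑ j, z j = 0) :
    𝔼 ω : Fin m → ι, ‖∑ k, z (ω k)‖ ^ 2 = m * 𝔼 j, ‖z j‖ ^ 2 := by
  induction m with
  | zero => simp
  | succ m ih =>
    rw [Fintype.expect_fin_succ, Finset.expect_comm]
    have h : ∀ ω : Fin m → ι, 𝔼 j, ‖∑ k, z ((Fin.cons j ω : Fin (m + 1) → ι) k)‖ ^ 2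
        = 𝔼 j, ‖z j‖ ^ 2 + ‖∑ k, z (ω k)‖ ^ 2 := by
      intro ω
      simp only [Fin.sum_univ_succ, Fin.cons_zero, Fin.cons_succ]
      have h0 : 𝔼 j, inner ℝ (z j) (∑ k, z (ω k)) = 0 := by
        rw [Fintype.expect_eq_sum_div_card, ← sum_inner, hz, inner_zero_left, zero_div]
      simp only [norm_add_sq_real, Finset.expect_add_distrib, Fintype.expect_const,
        ← Finset.mul_expect, h0]
      ring
    simp only [h, Finset.expect_add_distrib, Fintype.expect_const, ih]
    push_cast; ring

/-- **Hoeffding's inequality** for independent uniform samples from a finite type. -/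
theorem proportion_add_le_sum_sample_le {ι : Type*} [Fintype ι] [Nonempty ι] {m : ℕ} (g : ι → ℝ)
    {c t : ℝ} (hm : 0 < m) (hc : 0 < c) (ht : 0 ≤ t) (hg : ∀ i j, |g i - g j| ≤ c) :
    proportion (fun ω : Fin m → ι => m * 𝔼 j, g j + t ≤ ∑ k, g (ω k))
      ≤ Real.exp (-(2 * t ^ 2 / (m * c ^ 2))) := by
  have := proportion_le_of_bounded_differences (fun ω : Fin m → ι => ∑ k, g (ω k)) hm hc ht
    fun ω k j => by rw [sum_update_sample_sub]; exact hg _ _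
  rwa [expect_sum_sample] at this

theorem proportion_mono {α : Type*} [Fintype α] {p q : α → Prop} (h : ∀ a, p a → q a) :
    proportion p ≤ proportion q := by
  refine Finset.expect_le_expect fun a _ => ?_
  exact Set.indicator_le_indicator_of_subset (fun a => h a) (fun _ => zero_le_one) a

/-- McDiarmid applied to the norm: replacing one index moves the sum by at most `2 * D`, and
Cauchy–Schwarz bounds the mean norm by the root of the second moment, hence by `√b`. -/
theorem proportion_sqrt_add_le_norm_sum_sample_le {ι V : Type*} [Fintype ι] [Nonempty ι]
    [NormedAddCommGroup V] [InnerProductSpace ℝ V] {m : ℕ} (z : ι → V) (hz : ∑ j, z j = 0)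
    {D t b : ℝ} (hm : 0 < m) (hD : 0 < D) (ht : 0 ≤ t) (hzD : ∀ j, ‖z j‖ ≤ D)
    (hb : m * 𝔼 j, ‖z j‖ ^ 2 ≤ b) :
    proportion (fun ω : Fin m → ι => √b + t ≤ ‖∑ k, z (ω k)‖)
      ≤ Real.exp (-(2 * t ^ 2 / (m * (2 * D) ^ 2))) := by
  have h := proportion_le_of_bounded_differences (fun ω : Fin m → ι => ‖∑ k, z (ω k)‖) hm
    (c := 2 * D) (by positivity) ht fun ω k j => by
      refine (abs_norm_sub_norm_le _ _).trans ?_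
      rw [sum_update_sample_sub]
      exact (norm_sub_le _ _).trans (by linarith [hzD j, hzD (ω k)])
  refine (proportion_mono fun ω hω => ?_).trans h
  refine le_trans ?_ hω
  gcongr
  refine Real.le_sqrt_of_sq_le (le_trans ?_ hb)
  rw [← expect_norm_sq_sum_sample m z hz]
  have := Finset.expect_mul_sq_le_sq_mul_sq Finset.univ
    (fun ω : Fin m → ι => ‖∑ k, z (ω k)‖) (fun _ => 1)
  simpa [Fintype.expect_const] using this

theorem proportion_not {α : Type*} [Fintype α] [Nonempty α] (p : α → Prop) :
    proportion (fun a => ¬ p a) = 1 - proportion p := by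
  rw [eq_sub_iff_add_eq]
  unfold proportion
  rw [← Finset.expect_add_distrib, ← Fintype.expect_const (ι := α) (1 : ℝ)]
  refine Finset.expect_congr rfl fun a _ => ?_
  by_cases h : p a <;> simp [Set.indicator, h]

/-- Events about independent uniform indices have the frequency of the corresponding set of
samples as their probability. -/
theorem measureReal_sample_eq_proportion {E : Type*} [MeasurableSpace E] (P : Measure E)
    [IsProbabilityMeasure P] {n m : ℕ} [NeZero n] (Ω : Fin m → E → Fin n)
    (hΩ_meas : ∀ k, Measurable (Ω k)) (hΩ_indep : iIndepFun Ω P)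
    (hΩ_unif : ∀ k, P.map (Ω k) = uniformOn Set.univ) (p : (Fin m → Fin n) → Prop) :
    P.real {e | p fun k => Ω k e} = proportion p := by
  classical
  have hmeas : Measurable fun e k => Ω k e := measurable_pi_lambda _ hΩ_meas
  have hmap := (iIndepFun_iff_map_fun_eq_pi_map fun k => (hΩ_meas k).aemeasurable).1 hΩ_indep
  have : ∀ k, IsProbabilityMeasure (P.map (Ω k)) := fun k =>
    Measure.isProbabilityMeasure_map (hΩ_meas k).aemeasurable
  have hprob : IsProbabilityMeasure (P.map fun e k => Ω k e) :=
    Measure.isProbabilityMeasure_map hmeas.aemeasurable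
  have h1 : P.real {e | p fun k => Ω k e} = (P.map fun e k => Ω k e).real {ω | p ω} := by
    rw [map_measureReal_apply hmeas (Set.toFinite _).measurableSet]; rfl
  have hs : ∀ ω : Fin m → Fin n,
      (P.map fun e k => Ω k e).real {ω} = (Fintype.card (Fin m → Fin n) : ℝ)⁻¹ := by
    intro ω
    rw [hmap, measureReal_def, ← Set.univ_pi_singleton, Measure.pi_pi]
    simp [hΩ_unif, uniformOn_univ]
  have hset : {ω | p ω} = ↑(Finset.univ.filter p) := by ext; simp
  rw [h1, hset, ← sum_measureReal_singleton, proportion, Fintype.expect_eq_sum_div_card]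
  simp only [hs, Finset.sum_const, nsmul_eq_mul, Set.indicator_apply, Set.mem_ofPred_eq,
    Pi.one_apply, Finset.sum_boole]
  rfl

end SampleSums

/-! ### The sampled projection, its residual, and coherence. -/

section Geometry
open scoped BigOperators

/-- The only property of the pseudoinverse that is needed: residuals are orthogonal to the columns
of `W`, even when `Wᵀ * W` is singular. With `C` as below, `C Wᵀ W = 0` forces `(C Wᵀ) (C Wᵀ)ᵀ = 0`,
hence `C Wᵀ = 0`. -/
theorem Matrix.transpose_mul_mul_pinv_mul_transpose {k l : ℕ} (W : Matrix (Fin k) (Fin l) ℝ) :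
    Wᵀ * (W * pinv (Wᵀ * W) * Wᵀ) = Wᵀ := by
  have hA := (pinv_spec (Wᵀ * W)).mul_mul_self
  set C := Wᵀ * W * pinv (Wᵀ * W) - 1 with hC
  have h0 : C * Wᵀ * W = 0 := by
    rw [Matrix.mul_assoc, hC, Matrix.sub_mul, hA, Matrix.one_mul, sub_self]
  have h1 : C * Wᵀ = 0 := by
    rw [← Matrix.self_mul_conjTranspose_eq_zero, Matrix.conjTranspose_eq_transpose_of_trivial,
      Matrix.transpose_mul, Matrix.transpose_transpose, ← Matrix.mul_assoc, h0, Matrix.zero_mul]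
  rw [hC, Matrix.sub_mul, Matrix.one_mul, sub_eq_zero] at h1
  simpa only [Matrix.mul_assoc] using h1

variable {n m r : ℕ} {S : Submodule ℝ (EuclideanSpace ℝ (Fin n))} {U : Matrix (Fin n) (Fin r) ℝ}

theorem mulVec_mem_of_span_col (hU : Submodule.span ℝ (Set.range fun i => WithLp.toLp 2 (U.col i)) = S)
    (q : Fin r → ℝ) : WithLp.toLp 2 (U *ᵥ q) ∈ S := by
  rw [← hU, Submodule.mem_span_range_iff_exists_fun]
  refine ⟨q, ?_⟩
  ext j
  simp [Matrix.mulVec, dotProduct, mul_comm]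

theorem exists_mulVec_eq_of_span_col
    (hU : Submodule.span ℝ (Set.range fun i => WithLp.toLp 2 (U.col i)) = S)
    {s : EuclideanSpace ℝ (Fin n)} (hs : s ∈ S) : ∃ q : Fin r → ℝ, U *ᵥ q = s.ofLp := by
  rw [← hU, Submodule.mem_span_range_iff_exists_fun] at hs
  obtain ⟨q, rfl⟩ := hs
  refine ⟨q, ?_⟩
  ext j
  simp [Matrix.mulVec, dotProduct, mul_comm]

theorem sampleRows_mulVec (U : Matrix (Fin n) (Fin r) ℝ) (ω : Fin m → Fin n) (q : Fin r → ℝ) :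
    WithLp.toLp 2 (sampleRows U ω *ᵥ q) = sampleVec (WithLp.toLp 2 (U *ᵥ q)) ω := rfl

theorem sampleVec_add (v w : EuclideanSpace ℝ (Fin n)) (ω : Fin m → Fin n) :
    sampleVec (v + w) ω = sampleVec v ω + sampleVec w ω := rfl

theorem sampleVec_sub (v w : EuclideanSpace ℝ (Fin n)) (ω : Fin m → Fin n) :
    sampleVec (v - w) ω = sampleVec v ω - sampleVec w ω := rfl

theorem norm_sq_sampleVec (v : EuclideanSpace ℝ (Fin n)) (ω : Fin m → Fin n) :
    ‖sampleVec v ω‖ ^ 2 = ∑ k, v (ω k) ^ 2 := by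
  rw [EuclideanSpace.real_norm_sq_eq]; rfl

theorem sampleProj_eq (U : Matrix (Fin n) (Fin r) ℝ) (ω : Fin m → Fin n)
    (w : EuclideanSpace ℝ (Fin m)) : ∃ q : Fin r → ℝ,
    sampleProj U ω w = sampleVec (WithLp.toLp 2 (U *ᵥ q)) ω := by
  refine ⟨pinv ((sampleRows U ω)ᵀ * sampleRows U ω) *ᵥ ((sampleRows U ω)ᵀ *ᵥ w.ofLp), ?_⟩
  rw [← sampleRows_mulVec, sampleProj, Matrix.mulVec_mulVec, Matrix.mulVec_mulVec]

theorem inner_sub_sampleProj_eq_zero (U : Matrix (Fin n) (Fin r) ℝ) (ω : Fin m → Fin n)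
    (w : EuclideanSpace ℝ (Fin m)) (q : Fin r → ℝ) :
    inner ℝ (w - sampleProj U ω w) (sampleVec (WithLp.toLp 2 (U *ᵥ q)) ω) = 0 := by
  rw [← sampleRows_mulVec, EuclideanSpace.inner_eq_star_dotProduct, star_trivial, dotProduct_comm,
    Matrix.dotProduct_mulVec, ← Matrix.mulVec_transpose]
  have : (sampleRows U ω)ᵀ *ᵥ (w - sampleProj U ω w).ofLp = 0 := by
    rw [WithLp.ofLp_sub, Matrix.mulVec_sub, sampleProj, Matrix.mulVec_mulVec,
      Matrix.transpose_mul_mul_pinv_mul_transpose, sub_self]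
  rw [this, zero_dotProduct]

/-- The residual is the sample of the orthogonal part, up to the sample of a vector of `S`, to
which it is orthogonal. -/
theorem exists_sampleVec_eq_residual_add
    (hU : Submodule.span ℝ (Set.range fun i => WithLp.toLp 2 (U.col i)) = S)
    {x : EuclideanSpace ℝ (Fin n)} (hx : x ∈ S) (y : EuclideanSpace ℝ (Fin n))
    (ω : Fin m → Fin n) : ∃ s ∈ S,
      sampleVec y ω
        = (sampleVec (x + y) ω - sampleProj U ω (sampleVec (x + y) ω)) + sampleVec s ω ∧
      inner ℝ (sampleVec (x + y) ω - sampleProj U ω (sampleVec (x + y) ω)) (sampleVec s ω) = 0 := by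
  obtain ⟨q, hq⟩ := sampleProj_eq U ω (sampleVec (x + y) ω)
  obtain ⟨p, hp⟩ := exists_mulVec_eq_of_span_col hU hx
  have hs : WithLp.toLp 2 (U *ᵥ (q - p)) = WithLp.toLp 2 (U *ᵥ q) - x := by
    rw [Matrix.mulVec_sub, hp]; rfl
  refine ⟨WithLp.toLp 2 (U *ᵥ (q - p)), mulVec_mem_of_span_col hU _, ?_,
    inner_sub_sampleProj_eq_zero U ω _ _⟩
  rw [hq, hs, sampleVec_add, sampleVec_sub]
  abel

theorem norm_sq_residual_le
    (hU : Submodule.span ℝ (Set.range fun i => WithLp.toLp 2 (U.col i)) = S)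
    {x : EuclideanSpace ℝ (Fin n)} (hx : x ∈ S) (y : EuclideanSpace ℝ (Fin n))
    (ω : Fin m → Fin n) :
    ‖sampleVec (x + y) ω - sampleProj U ω (sampleVec (x + y) ω)‖ ^ 2 ≤ ∑ k, y (ω k) ^ 2 := by
  obtain ⟨s, -, h, h0⟩ := exists_sampleVec_eq_residual_add hU hx y ω
  rw [← norm_sq_sampleVec, h, norm_add_sq_real, h0]
  nlinarith [sq_nonneg ‖sampleVec s ω‖]

/-- Since `s (ω k) = ⟪e_{ω k}, s⟫ = ⟪P_S e_{ω k}, s⟫`, the dependence on the unknown `s` separates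
from a sum of independent vectors. -/
theorem sum_apply_mul_eq_inner {s : EuclideanSpace ℝ (Fin n)} (hs : s ∈ S)
    (y : EuclideanSpace ℝ (Fin n)) (ω : Fin m → Fin n) :
    ∑ k, y (ω k) * s (ω k)
      = inner ℝ (∑ k, y (ω k) • S.starProjection (EuclideanSpace.single (ω k) (1 : ℝ))) s := by
  rw [sum_inner]
  refine Finset.sum_congr rfl fun k _ => ?_
  rw [inner_smul_left, Submodule.inner_starProjection_left_eq_right,
    Submodule.starProjection_eq_self_iff.2 hs, EuclideanSpace.inner_single_left]
  simp

/-- The residual is the sample of `y - s` with `s ∈ S` unknown; expanding its square and minimising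
`l ‖s‖² - 2 B ‖s‖` over all values of `‖s‖` costs at most `B² / l`. -/
theorem le_norm_sq_residual
    (hU : Submodule.span ℝ (Set.range fun i => WithLp.toLp 2 (U.col i)) = S)
    {x : EuclideanSpace ℝ (Fin n)} (hx : x ∈ S) (y : EuclideanSpace ℝ (Fin n))
    (ω : Fin m → Fin n) {l B : ℝ} (hl : 0 < l)
    (hS : ∀ s ∈ S, l * ‖s‖ ^ 2 ≤ ∑ k, s (ω k) ^ 2)
    (hB : ‖∑ k, y (ω k) • S.starProjection (EuclideanSpace.single (ω k) (1 : ℝ))‖ ≤ B) :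
    ∑ k, y (ω k) ^ 2 - B ^ 2 / l
      ≤ ‖sampleVec (x + y) ω - sampleProj U ω (sampleVec (x + y) ω)‖ ^ 2 := by
  obtain ⟨s, hs, h, -⟩ := exists_sampleVec_eq_residual_add hU hx y ω
  have e : sampleVec (x + y) ω - sampleProj U ω (sampleVec (x + y) ω)
      = sampleVec (y - s) ω := by
    rw [sampleVec_sub, h, add_sub_cancel_right]
  rw [e, norm_sq_sampleVec]
  have e2 : ∑ k, (y - s) (ω k) ^ 2
      = ∑ k, y (ω k) ^ 2 - 2 * ∑ k, y (ω k) * s (ω k) + ∑ k, s (ω k) ^ 2 := by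
    rw [Finset.mul_sum, ← Finset.sum_sub_distrib, ← Finset.sum_add_distrib]
    refine Finset.sum_congr rfl fun k _ => ?_
    rw [PiLp.sub_apply]; ring
  have h1 : ∑ k, y (ω k) * s (ω k) ≤ B * ‖s‖ := by
    rw [sum_apply_mul_eq_inner hs]
    exact (real_inner_le_norm _ _).trans (by gcongr)
  have h2 : 2 * (B * ‖s‖) ≤ B ^ 2 / l + l * ‖s‖ ^ 2 := by
    have : B ^ 2 / l + l * ‖s‖ ^ 2 - 2 * (B * ‖s‖) = (B - l * ‖s‖) ^ 2 / l := by
      field_simp; ring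
    have : 0 ≤ (B - l * ‖s‖) ^ 2 / l := by positivity
    linarith
  rw [e2]
  linarith [hS s hs]

/-- The lower tail of the smallest singular value of the sampled subspace. -/
theorem proportion_exists_sum_sample_sq_le [NeZero n]
    (S : Submodule ℝ (EuclideanSpace ℝ (Fin n))) {R γ : ℝ} (hR : 0 < R) (hγ : 0 ≤ γ)
    (hSR : ∀ j, ‖S.starProjection (EuclideanSpace.single j (1 : ℝ))‖ ^ 2 ≤ R) (m : ℕ) :
    proportion (fun ω : Fin m → Fin n => ∃ s ∈ S, ‖s‖ = 1 ∧
        ∑ k, s (ω k) ^ 2 ≤ (1 - γ) * (m / n))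
      ≤ Module.finrank ℝ S * Real.exp (-(γ ^ 2 / 2 * (m / (n * R)))) := by
  set b := stdOrthonormalBasis ℝ S
  -- `u j` holds the coordinates of `P_S e_j` in an orthonormal basis of `S`. The matrices `u_j
  -- u_jᵀ` sum to the identity and lie below `R`, and their quadratic form at the coordinates of `s`
  -- is `s j ^ 2`.
  set u : Fin n → Fin (Module.finrank ℝ S) → ℝ := fun j i => (b i : EuclideanSpace ℝ (Fin n)) j
  have hinner : ∀ j i, inner ℝ (b i) (S.orthogonalProjectionOnto (EuclideanSpace.single j (1 : ℝ)))
      = u j i := by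
    intro j i
    rw [Submodule.coe_inner, ← Submodule.starProjection_apply,
      ← Submodule.inner_starProjection_left_eq_right,
      Submodule.starProjection_eq_self_iff.2 (b i).2, EuclideanSpace.inner_single_right]
    simp [u]
  have hu : ∀ j, u j ⬝ᵥ u j ≤ R := by
    intro j
    refine le_trans (le_of_eq ?_) (hSR j)
    rw [Submodule.starProjection_apply, ← Submodule.coe_norm, ← b.sum_sq_norm_inner_right]
    simp only [hinner, dotProduct, Real.norm_eq_abs, sq_abs, ← sq]
  have hquad : ∀ j c, c ⬝ᵥ Matrix.vecMulVec (u j) (u j) *ᵥ c = (c ⬝ᵥ u j) ^ 2 := by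
    intro j c
    rw [Matrix.vecMulVec_mulVec, op_smul_eq_smul, dotProduct_smul, smul_eq_mul, dotProduct_comm (u j), sq]
  have h := Matrix.proportion_exists_dotProduct_mulVec_le
    (fun j => Matrix.vecMulVec (u j) (u j)) hR hγ
    (fun j => by simpa using Matrix.posSemidef_vecMulVec_self_star (u j)) (fun j => ?_) ?_ m
  · rw [Fintype.card_fin, Fintype.card_fin] at h
    refine (proportion_mono fun ω => ?_).trans h
    rintro ⟨s, hs, hs1, hle⟩
    set c : Fin (Module.finrank ℝ S) → ℝ := fun i => inner ℝ (b i) (⟨s, hs⟩ : S)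
    have hcu : ∀ j, c ⬝ᵥ u j = s j := by
      intro j
      have h1 := congrArg (fun t : S => (t : EuclideanSpace ℝ (Fin n)) j) (b.sum_repr ⟨s, hs⟩)
      simp only [b.repr_apply_apply] at h1
      rw [← h1]
      simp [dotProduct, c, u]
    refine ⟨c, ?_, ?_⟩
    · have h1 := b.sum_sq_norm_inner_right ⟨s, hs⟩
      rw [Submodule.coe_norm, hs1] at h1
      simpa [dotProduct, c, sq] using h1
    · rw [Matrix.sum_mulVec, dotProduct_sum]
      simp only [hquad, hcu]
      exact hle
  · refine Matrix.PosSemidef.of_dotProduct_mulVec_nonneg ?_ fun c => ?_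
    · rw [Matrix.IsHermitian, Matrix.conjTranspose_eq_transpose_of_trivial, Matrix.transpose_sub,
        Matrix.transpose_vecMulVec, Matrix.transpose_smul, Matrix.transpose_one]
    · rw [star_trivial, Matrix.sub_mulVec, dotProduct_sub, hquad, Matrix.smul_mulVec,
        Matrix.one_mulVec, dotProduct_smul, smul_eq_mul]
      have h1 := Finset.sum_mul_sq_le_sq_mul_sq Finset.univ c (u j)
      have h2 : (c ⬝ᵥ u j) ^ 2 ≤ (c ⬝ᵥ c) * (u j ⬝ᵥ u j) := by
        simpa only [dotProduct, sq] using h1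
      have h3 : 0 ≤ c ⬝ᵥ c := Finset.sum_nonneg fun i _ => mul_self_nonneg _
      nlinarith [hu j]
  · ext i i'
    have h1 := (orthonormal_iff_ite.1 b.orthonormal) i i'
    rw [Submodule.coe_inner, PiLp.inner_apply] at h1
    rw [Matrix.sum_apply, Matrix.one_apply, ← h1]
    refine Finset.sum_congr rfl fun j _ => ?_
    simp [Matrix.vecMulVec_apply, u, mul_comm]

theorem norm_sq_starProjection_single_le (hS : Module.finrank ℝ S ≠ 0) (hn : n ≠ 0) (j : Fin n) :
    ‖S.starProjection (EuclideanSpace.single j (1 : ℝ))‖ ^ 2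
      ≤ Module.finrank ℝ S * coherence S / n := by
  have h := le_ciSup (f := fun j : Fin n =>
    ‖S.starProjection (EuclideanSpace.single j (1 : ℝ))‖ ^ 2) (Set.finite_range _).bddAbove j
  refine h.trans (le_of_eq ?_)
  have h1 : (Module.finrank ℝ S : ℝ) ≠ 0 := by exact_mod_cast hS
  have h2 : (n : ℝ) ≠ 0 := by exact_mod_cast hn
  rw [coherence]
  field_simp

theorem coherence_pos (hS : S ≠ ⊥) : 0 < coherence S := by
  have hr : 0 < Module.finrank ℝ S := by
    rw [Nat.pos_iff_ne_zero, ne_eq, Submodule.finrank_eq_zero]; exact hS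
  obtain ⟨s, hs, hs0⟩ := Submodule.exists_mem_ne_zero_of_ne_bot hS
  obtain ⟨j, hj⟩ : ∃ j, s j ≠ 0 := by
    by_contra! h
    exact hs0 (by ext j; simpa using h j)
  have hn : 0 < n := j.pos
  have h := le_ciSup (f := fun j : Fin n =>
    ‖S.starProjection (EuclideanSpace.single j (1 : ℝ))‖ ^ 2) (Set.finite_range _).bddAbove j
  have h1 : S.starProjection (EuclideanSpace.single j (1 : ℝ)) ≠ 0 := by
    intro h0
    rw [Submodule.starProjection_apply_eq_zero_iff] at h0
    have := h0 s hs
    rw [EuclideanSpace.inner_single_right] at this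
    exact hj (by simpa using this)
  have h2 : 0 < ‖S.starProjection (EuclideanSpace.single j (1 : ℝ))‖ ^ 2 := by positivity
  exact mul_pos (by positivity) (h2.trans_le h)

/-- The projection of `e_j` onto the line of `y` has norm `|y j| / ‖y‖`. -/
theorem sq_apply_le_vecCoherence {y : EuclideanSpace ℝ (Fin n)} (hy : y ≠ 0) (j : Fin n) :
    y j ^ 2 ≤ vecCoherence y * ‖y‖ ^ 2 / n := by
  have hf : Module.finrank ℝ (Submodule.span ℝ {y}) = 1 := finrank_span_singleton hy
  have h := norm_sq_starProjection_single_le (S := Submodule.span ℝ {y}) (by rw [hf]; exact one_ne_zero)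
    j.pos.ne' j
  rw [hf, Submodule.starProjection_singleton, EuclideanSpace.inner_single_right, norm_smul,
    Nat.cast_one, one_mul] at h
  have hp : 0 < ‖y‖ := norm_pos_iff.2 hy
  have e : (‖(starRingEnd ℝ) (y j) / (‖y‖ ^ 2 : ℝ)‖ * ‖y‖) ^ 2 = y j ^ 2 / ‖y‖ ^ 2 := by
    simp only [conj_trivial, norm_div, Real.norm_eq_abs, abs_pow, abs_norm, mul_pow, div_pow,
      sq_abs]
    field_simp
  have h' : y j ^ 2 / ‖y‖ ^ 2 ≤ vecCoherence y / n := by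
    rw [← e, vecCoherence]
    simpa only [one_mul, RCLike.ofReal_real_eq_id, id] using h
  rw [div_le_iff₀ (by positivity)] at h'
  rwa [div_mul_eq_mul_div] at h'

/-- The sum is `P_S y`; its vanishing is the centring needed for the vector concentration bound. -/
theorem sum_apply_smul_starProjection_single {y : EuclideanSpace ℝ (Fin n)} (hy : y ∈ Sᗮ) :
    ∑ j, y j • S.starProjection (EuclideanSpace.single j (1 : ℝ)) = 0 := by
  have h : ∑ j, y j • EuclideanSpace.single j (1 : ℝ) = y := by
    ext i
    simp [Pi.single_apply]
  have h0 := (Submodule.starProjection_apply_eq_zero_iff S).2 hy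
  rw [← h, map_sum] at h0
  simpa using h0

end Geometry

/-! ### The four deviation events and their constants. -/

section Detection
open scoped BigOperators

/-- The deviation bounds that hold for a sample with probability at least `1 - 4 δ`. -/
theorem proportion_deviation_le {n m r : ℕ} [NeZero n] (hr : 1 ≤ r)
    (S : Submodule ℝ (EuclideanSpace ℝ (Fin n))) (hS : Module.finrank ℝ S = r)
    (y : EuclideanSpace ℝ (Fin n)) (hy : y ∈ Sᗮ) (hy0 : y ≠ 0)
    (δ : ℝ) (hδ : 0 < δ) (hδ1 : δ < 1) (hm0 : 0 < m) (R : ℝ) (hR : R = r * coherence S / n)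
    (hl : 0 ≤ Real.log (2 * r / δ))
    (α β γ : ℝ)
    (hα : α = √(2 * vecCoherence y ^ 2 / m * Real.log (1 / δ)))
    (hβ : β = √(2 * vecCoherence y * Real.log (1 / δ)))
    (hγ : γ = √(8 * r * coherence S / (3 * m) * Real.log (2 * r / δ))) :
    proportion (fun ω : Fin m → Fin n =>
      (((1 + α) * (m / n) * ‖y‖ ^ 2 ≤ ∑ k, y (ω k) ^ 2) ∨
        ∑ k, y (ω k) ^ 2 ≤ (1 - α) * (m / n) * ‖y‖ ^ 2) ∨
      ((1 + β) * √(m * R * ‖y‖ ^ 2 / n)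
          ≤ ‖∑ k, y (ω k) • S.starProjection (EuclideanSpace.single (ω k) (1 : ℝ))‖ ∨
        ∃ s ∈ S, ‖s‖ = 1 ∧ ∑ k, s (ω k) ^ 2 ≤ (1 - γ) * (m / n))) ≤ 4 * δ := by
  have hn0 : n ≠ 0 := NeZero.ne n
  have hn : (0 : ℝ) < n := by exact_mod_cast Nat.pos_of_ne_zero hn0
  have hm : (0 : ℝ) < m := by exact_mod_cast hm0
  have hrp : (0 : ℝ) < r := by exact_mod_cast hr
  have hSbot : S ≠ ⊥ := by
    rintro rfl
    rw [finrank_bot] at hS; omega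
  have hcoh : 0 < coherence S := coherence_pos hSbot
  have hRpos : 0 < R := by rw [hR]; positivity
  have hμ : 0 < vecCoherence y := coherence_pos (by simpa [Submodule.span_singleton_eq_bot] using hy0)
  set μ := vecCoherence y
  have hyn : 0 < ‖y‖ := norm_pos_iff.2 hy0
  have hyM : ∀ j, y j ^ 2 ≤ μ * ‖y‖ ^ 2 / n := sq_apply_le_vecCoherence hy0
  have haR : ∀ j, ‖S.starProjection (EuclideanSpace.single j (1 : ℝ))‖ ^ 2 ≤ R := by
    intro j
    have := norm_sq_starProjection_single_le (S := S) (by omega) hn0 j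
    rwa [hS, ← hR] at this
  set L := Real.log (1 / δ) with hL
  have hL0 : 0 < L := Real.log_pos (by rw [lt_div_iff₀ hδ]; linarith)
  have hexpL : Real.exp (-L) = δ := by
    rw [hL, one_div, Real.log_inv, neg_neg, Real.exp_log hδ]
  have hα2 : α ^ 2 = 2 * μ ^ 2 / m * L := by rw [hα, Real.sq_sqrt (by positivity)]
  have hβ2 : β ^ 2 = 2 * μ * L := by rw [hβ, Real.sq_sqrt (by positivity)]
  have hα0 : 0 ≤ α := by rw [hα]; positivity
  have hβ0 : 0 ≤ β := by rw [hβ]; positivity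
  have hγ0 : 0 ≤ γ := by rw [hγ]; positivity
  have hmean : 𝔼 j, y j ^ 2 = ‖y‖ ^ 2 / n := by
    rw [Fintype.expect_eq_sum_div_card, ← EuclideanSpace.real_norm_sq_eq, Fintype.card_fin]
  have hdiff : ∀ i j, |y i ^ 2 - y j ^ 2| ≤ μ * ‖y‖ ^ 2 / n := by
    intro i j
    rw [abs_le]
    constructor <;> linarith [hyM i, hyM j, sq_nonneg (y i), sq_nonneg (y j)]
  -- The exponent is `4 * L`, so each tail is even at most `δ ^ 4`.
  have hexp1 : Real.exp (-(2 * (α * (m / n) * ‖y‖ ^ 2) ^ 2 / (m * (μ * ‖y‖ ^ 2 / n) ^ 2))) ≤ δ := by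
    rw [← hexpL]
    refine Real.exp_le_exp.2 (neg_le_neg ?_)
    have : 2 * (α * (m / n) * ‖y‖ ^ 2) ^ 2 / (m * (μ * ‖y‖ ^ 2 / n) ^ 2) = 4 * L := by
      rw [mul_pow, mul_pow, hα2]; field_simp; ring
    linarith
  have h1 : proportion (fun ω : Fin m → Fin n =>
      (1 + α) * (m / n) * ‖y‖ ^ 2 ≤ ∑ k, y (ω k) ^ 2) ≤ δ := by
    have := proportion_add_le_sum_sample_le (m := m) (fun j => y j ^ 2)
      (t := α * (m / n) * ‖y‖ ^ 2) hm0 (by positivity) (by positivity) hdiff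
    refine (proportion_mono fun ω hω => ?_).trans (this.trans hexp1)
    rw [hmean]
    refine le_trans (le_of_eq ?_) hω
    ring
  have h2 : proportion (fun ω : Fin m → Fin n =>
      ∑ k, y (ω k) ^ 2 ≤ (1 - α) * (m / n) * ‖y‖ ^ 2) ≤ δ := by
    have := proportion_add_le_sum_sample_le (m := m) (fun j => -(y j ^ 2))
      (t := α * (m / n) * ‖y‖ ^ 2) hm0 (c := μ * ‖y‖ ^ 2 / n) (by positivity) (by positivity)
      fun i j => by rw [neg_sub_neg]; exact hdiff j i
    refine (proportion_mono fun ω hω => ?_).trans (this.trans hexp1)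
    rw [Finset.expect_neg_distrib, hmean, Finset.sum_neg_distrib]
    have e : m * -(‖y‖ ^ 2 / n) + α * (m / n) * ‖y‖ ^ 2 = -((1 - α) * (m / n) * ‖y‖ ^ 2) := by ring
    rw [e]
    exact neg_le_neg hω
  have h3 : proportion (fun ω : Fin m → Fin n => (1 + β) * √(m * R * ‖y‖ ^ 2 / n)
      ≤ ‖∑ k, y (ω k) • S.starProjection (EuclideanSpace.single (ω k) (1 : ℝ))‖) ≤ δ := by
    have hz2 : ∀ j, ‖y j • S.starProjection (EuclideanSpace.single j (1 : ℝ))‖ ^ 2 ≤ y j ^ 2 * R := by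
      intro j
      rw [norm_smul, mul_pow, Real.norm_eq_abs, sq_abs]
      exact mul_le_mul_of_nonneg_left (haR j) (sq_nonneg _)
    -- Each term has squared norm at most `y j ^ 2 * R`. Bounding `y j ^ 2` by coherence gives `D`,
    -- averaging it gives `b`, and with `t = β √b` the exponent is exactly `L`.
    have := proportion_sqrt_add_le_norm_sum_sample_le (m := m)
      (fun j => y j • S.starProjection (EuclideanSpace.single j (1 : ℝ)))
      (sum_apply_smul_starProjection_single hy) (D := √(μ * ‖y‖ ^ 2 / n * R))
      (t := β * √(m * R * ‖y‖ ^ 2 / n)) (b := m * R * ‖y‖ ^ 2 / n) hm0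
      (Real.sqrt_pos.2 (by positivity)) (by positivity)
      (fun j => Real.le_sqrt_of_sq_le
        ((hz2 j).trans (mul_le_mul_of_nonneg_right (hyM j) hRpos.le))) (by
        have h := Finset.expect_le_expect fun j (_ : j ∈ Finset.univ) => hz2 j
        rw [← Finset.expect_mul, hmean] at h
        calc _ ≤ m * (‖y‖ ^ 2 / n * R) := by gcongr
          _ = _ := by ring)
    refine (proportion_mono fun ω hω => ?_).trans (this.trans ?_)
    · refine le_trans (le_of_eq ?_) hω
      ring
    · rw [← hexpL]
      refine Real.exp_le_exp.2 (neg_le_neg (le_of_eq ?_))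
      rw [mul_pow, mul_pow, Real.sq_sqrt (by positivity), Real.sq_sqrt (by positivity), hβ2]
      field_simp
  have h4 : proportion (fun ω : Fin m → Fin n => ∃ s ∈ S, ‖s‖ = 1 ∧
      ∑ k, s (ω k) ^ 2 ≤ (1 - γ) * (m / n)) ≤ δ := by
    refine (proportion_exists_sum_sample_sq_le S hRpos hγ0 haR m).trans ?_
    set l := Real.log (2 * r / δ) with hl_def
    have hγ2 : γ ^ 2 = 8 * r * coherence S / (3 * m) * l := by
      rw [hγ, Real.sq_sqrt (by positivity)]
    -- The factor `4 / 3` is slack: `r * exp (-l) = δ / 2` would suffice.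
    have e : γ ^ 2 / 2 * (m / (n * R)) = 4 / 3 * l := by
      rw [hγ2, hR]; field_simp; ring
    rw [hS, e]
    calc r * Real.exp (-(4 / 3 * l)) ≤ r * Real.exp (-l) := by gcongr; linarith
      _ = δ / 2 := by
        rw [Real.exp_neg, hl_def, Real.exp_log (by positivity)]; field_simp
      _ ≤ δ := by linarith
  refine (proportion_or_le _ _).trans ?_
  have := proportion_or_le (fun ω : Fin m → Fin n =>
    (1 + α) * (m / n) * ‖y‖ ^ 2 ≤ ∑ k, y (ω k) ^ 2)
    (fun ω => ∑ k, y (ω k) ^ 2 ≤ (1 - α) * (m / n) * ‖y‖ ^ 2)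
  have := proportion_or_le (fun ω : Fin m → Fin n => (1 + β) * √(m * R * ‖y‖ ^ 2 / n)
      ≤ ‖∑ k, y (ω k) • S.starProjection (EuclideanSpace.single (ω k) (1 : ℝ))‖)
    (fun ω => ∃ s ∈ S, ‖s‖ = 1 ∧ ∑ k, s (ω k) ^ 2 ≤ (1 - γ) * (m / n))
  linarith

end Detection

/-! ### Assembly of the theorem. -/

theorem theorem1 {E : Type*} [MeasurableSpace E] (P : Measure E) [IsProbabilityMeasure P]
    {n m r : ℕ} (hr : 1 ≤ r)
    (S : Submodule ℝ (EuclideanSpace ℝ (Fin n))) (hS : Module.finrank ℝ S = r)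
    -- the columns of `U` span `S`
    (U : Matrix (Fin n) (Fin r) ℝ)
    (hU : Submodule.span ℝ (Set.range fun i : Fin r => WithLp.toLp 2 (U.col i)) = S)
    (v x y : EuclideanSpace ℝ (Fin n)) (hv : v = x + y) (hx : x ∈ S) (hy : y ∈ Sᗮ)
    -- `m` independent indices, each uniform on the `n` coordinates
    (Ω : Fin m → E → Fin n) (hΩ_meas : ∀ k, Measurable (Ω k)) (hΩ_indep : iIndepFun Ω P)
    (hΩ_unif : ∀ k, P.map (Ω k) = uniformOn Set.univ)
    (δ : ℝ) (hδ : 0 < δ)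
    (hm : 8 / 3 * (r : ℝ) * coherence S * Real.log (2 * r / δ) ≤ (m : ℝ))
    (α β γ : ℝ)
    (hα : α = √(2 * vecCoherence y ^ 2 / m * Real.log (1 / δ)))
    (hβ : β = √(2 * vecCoherence y * Real.log (1 / δ)))
    (hγ : γ = √(8 * r * coherence S / (3 * m) * Real.log (2 * r / δ))) :
    1 - 4 * δ ≤ P.real {e : E |
      -- if `γ = 1` (equality in the bound on `m`), the lower bound reads `-∞`
      (γ < 1 →
        (m * (1 - α) - r * coherence S * ((1 + β) ^ 2 / (1 - γ))) / n
            * ‖v - S.starProjection v‖ ^ 2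
          ≤ ‖sampleVec v (fun k => Ω k e)
              - sampleProj U (fun k => Ω k e) (sampleVec v (fun k => Ω k e))‖ ^ 2) ∧
      ‖sampleVec v (fun k => Ω k e)
          - sampleProj U (fun k => Ω k e) (sampleVec v (fun k => Ω k e))‖ ^ 2
        ≤ (1 + α) * (m / n) * ‖v - S.starProjection v‖ ^ 2} := by
  by_cases hδ4 : 1 - 4 * δ ≤ 0
  · exact hδ4.trans measureReal_nonneg
  have hδ1 : δ < 1 := by linarith
  have hrp : (1 : ℝ) ≤ r := by exact_mod_cast hr
  have hSbot : S ≠ ⊥ := by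
    rintro rfl
    rw [finrank_bot] at hS; omega
  have hn0 : NeZero n := ⟨by
    rintro rfl
    exact hSbot (Subsingleton.elim _ _)⟩
  have hn : (0 : ℝ) < n := by exact_mod_cast Nat.pos_of_ne_zero hn0.out
  have hcoh : 0 < coherence S := coherence_pos hSbot
  have hl : 0 < Real.log (2 * r / δ) := Real.log_pos (by rw [lt_div_iff₀ hδ]; linarith)
  have hmR : (0 : ℝ) < m := lt_of_lt_of_le (by positivity) hm
  have hm0 : 0 < m := by exact_mod_cast hmR
  have hproj : v - S.starProjection v = y := by
    rw [hv, map_add, Submodule.starProjection_eq_self_iff.2 hx,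
      (Submodule.starProjection_apply_eq_zero_iff S).2 hy]
    simp
  rw [hproj, measureReal_sample_eq_proportion P Ω hΩ_meas hΩ_indep hΩ_unif (fun ω =>
      (γ < 1 →
        (m * (1 - α) - r * coherence S * ((1 + β) ^ 2 / (1 - γ))) / n * ‖y‖ ^ 2
          ≤ ‖sampleVec v ω - sampleProj U ω (sampleVec v ω)‖ ^ 2) ∧
      ‖sampleVec v ω - sampleProj U ω (sampleVec v ω)‖ ^ 2 ≤ (1 + α) * (m / n) * ‖y‖ ^ 2),
    sub_le_comm, ← proportion_not, hv]
  have hupper := fun ω : Fin m → Fin n => norm_sq_residual_le hU hx y ω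
  -- For `y = 0` the coherence is `0` and the concentration bounds degenerate, but the residual
  -- vanishes for every sample.
  by_cases hy0 : y = 0
  · refine le_trans (le_of_eq ?_) (by positivity : 0 ≤ 4 * δ)
    refine Finset.expect_eq_zero fun ω _ => Set.indicator_of_notMem ?_ _
    rw [Set.mem_ofPred_eq, not_not]
    have := hupper ω
    subst hy0
    refine ⟨fun _ => ?_, ?_⟩
    · rw [norm_zero, zero_pow two_ne_zero, mul_zero]
      positivity
    · simpa using this
  set R := r * coherence S / n with hR
  have hRpos : 0 < R := by positivity
  refine (proportion_mono fun ω hω => ?_).trans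
    (proportion_deviation_le hr S hS y hy hy0 δ hδ hδ1 hm0 R hR hl.le α β γ hα hβ hγ)
  by_contra! hcon
  obtain ⟨⟨hc1, hc2⟩, hc3, hc4⟩ := hcon
  refine hω ⟨fun hγ1 => ?_, (hupper ω).trans hc1.le⟩
  have hγ' : 0 < 1 - γ := by linarith
  have hlpos : 0 < (1 - γ) * (m / n) := by positivity
  have hsing : ∀ s ∈ S, (1 - γ) * (m / n) * ‖s‖ ^ 2 ≤ ∑ k, s (ω k) ^ 2 := by
    intro s hs
    by_cases hs0 : s = 0
    · simp [hs0]
    have hsn : 0 < ‖s‖ := norm_pos_iff.2 hs0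
    have h := hc4 (‖s‖⁻¹ • s) (S.smul_mem _ hs) (by
      rw [norm_smul, norm_inv, norm_norm, inv_mul_cancel₀ hsn.ne'])
    simp only [PiLp.smul_apply, smul_eq_mul, mul_pow, ← Finset.mul_sum] at h
    rw [inv_pow, ← div_eq_inv_mul, lt_div_iff₀ (by positivity)] at h
    exact h.le
  refine le_trans ?_ (le_norm_sq_residual hU hx y ω hlpos hsing hc3.le)
  rw [mul_pow, Real.sq_sqrt (by positivity)]
  -- In `B ^ 2 / l` the factor `m / n` cancels, leaving `R = r μ(S) / n` times `(1 + β) ^ 2 / (1 -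
  -- γ) * ‖y‖ ^ 2`.
  have e : (m * (1 - α) - r * coherence S * ((1 + β) ^ 2 / (1 - γ))) / n * ‖y‖ ^ 2
      = (1 - α) * (m / n) * ‖y‖ ^ 2
        - (1 + β) ^ 2 * (m * R * ‖y‖ ^ 2 / n) / ((1 - γ) * (m / n)) := by
    rw [hR]; field_simp
  rw [e]
  linarith
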